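/- \textbf{Types and rules.} Simple types are generated from $N$ by $\to$; a sequent $\vec\sigma\Rightarrow\tau$ consists of a list of types $\vec\sigma$ (possibly empty) and a type $\tau$, and has associated type $\vec\sigma\to\tau$. The rules are $$\mathsf{id}:\ \sigma\Rightarrow\sigma;\qquad \mathsf{ex}:\ \frac{\vec\rho,\sigma,\rho,\vec\sigma\Rightarrow\tau}{\vec\rho,\rho,\sigma,\vec\sigma\Rightarrow\tau};\qquad \mathsf{wk}:\ \frac{\vec\sigma\Rightarrow\tau}{\vec\sigma,\sigma\Rightarrow\tau};\qquad \mathsf{cntr}:\ \frac{\vec\sigma,\sigma,\sigma\Rightarrow\tau}{\vec\sigma,\sigma\Rightarrow\tau};\qquad \mathsf{cut}:\ \frac{\vec\sigma\Rightarrow\sigma\quad \vec\sigma,\sigma\Rightarrow\tau}{\vec\sigma\Rightarrow\tau};$$ $$\mathsf L:\ \frac{\vec\sigma\Rightarrow\rho\quad\vec\sigma,\sigma\Rightarrow\tau}{\vec\sigma,\rho\to\sigma\Rightarrow\tau};\qquad \mathsf R:\ \frac{\vec\sigma,\sigma\Rightarrow\tau}{\vec\sigma\Rightarrow\sigma\to\tau};\qquad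 0:\ \Rightarrow N;\qquad \mathsf s:\ N\Rightarrow N;\qquad \mathsf{cond}:\ \frac{\vec\sigma\Rightarrow\tau\quad\vec\sigma,N\Rightarrow\tau}{\vec\sigma,N\Rightarrow\tau}.$$ Each rule instance is a constant whose type is the function type from the types of its premisses to the type of its conclusion. A \emph{coterm} is a possibly infinite (height $\le\omega$) binary tree of typed applications whose leaves are typed variables or constants. A \emph{coderivation} is a possibly infinite, locally correct tree of rule instances; it is read as a coterm by applying the constant at each node to the coterms of the immediate sub-coderivations. It is \emph{regular} if it has finitely many distinct sub-coderivations. \textbf{Progress.} A type occurrence on the left of a premiss is an immediate ancestor of one on the left of the conclusion if the two correspond in a common list of side types ($\vec\sigma$; $\vec\rho$ and $\vec\sigma$ for $\mathsf{ex}$), are the corresponding exchanged types of $\mathsf{ex}$, are a copy and the contracted type of $\mathsf{cntr}$, or are the displayed $N$ in the right premiss and the displayed (principal) $N$ in the conclusion of $\mathsf{cond}$. A coderivation is \emph{progressing} if every infinite branch has, from some point on, an infinite thread (path of immediate ancestry) of occurrences of $N$ along it that is infinitely often principal for a $\mathsf{cond}$ step. A \emph{$CT$ coterm} is a finite (typed)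 application of regular progressing coderivations, constants and variables. \textbf{Reduction.} $\rightsquigarrow$ is the closure under contexts of $$\begin{array}{ll}\mathsf{id}\,x\rightsquigarrow x, & \mathsf{ex}\,t\,\vec x\,x\,y\,\vec y\rightsquigarrow t\,\vec x\,y\,x\,\vec y,\\ \mathsf{wk}\,t\,\vec x\,x\rightsquigarrow t\,\vec x, & \mathsf{cntr}\,t\,\vec x\,x\rightsquigarrow t\,\vec x\,x\,x,\\ \mathsf{cut}\,s\,t\,\vec x\rightsquigarrow t\,\vec x\,(s\,\vec x), & \mathsf L\,s\,t\,\vec x\,y\rightsquigarrow t\,\vec x\,(y\,(s\,\vec x)),\\ \mathsf R\,t\,\vec x\,x\rightsquigarrow t\,\vec x\,x, & \\ \mathsf{cond}\,s\,t\,\vec x\,0\rightsquigarrow s\,\vec x, & \mathsf{cond}\,s\,t\,\vec x\,(\mathsf s\,y)\rightsquigarrow t\,\vec x\,y,\end{array}$$ where the letters range over coterms of the appropriate types and $\vec x,\vec y$ over lists, possibly empty, of the lengths given by the rule instance. A redex of a coterm is an occurrence of a left-hand side. \textbf{Corollary (Strong normalisation for $CT$).} Let $t$ be a closed $CT$ coterm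 (of any type) that has only finitely many redexes. Then $t$ is strongly normalising, i.e. there is no infinite sequence $t=t_0\rightsquigarrow t_1\rightsquigarrow t_2\rightsquigarrow\cdots$, and there is exactly one normal coterm $u$ with $t\rightsquigarrow^* u$. -/

import Mathlib

namespace CircularT

/-- Simple types. -/
inductive Ty : Type
  | N : Ty
  | arr : Ty → Ty → Ty

/-- `arrs [σ₁, …, σₙ] τ` is the type `σ₁ → ⋯ → σₙ → τ`. -/
def arrs : List Ty → Ty → Ty
  | [], τ => τ
  | σ :: Γ, τ => Ty.arr σ (arrs Γ τ)

/-- The sequent `Γ ⇒ τ` is the pair `(Γ, τ)`. -/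
abbrev Sequent : Type := List Ty × Ty

/-- The type `Γ → τ` of the terms associated with the sequent `Γ ⇒ τ`. -/
def Sequent.ty (s : Sequent) : Ty := arrs s.1 s.2

/-- The rule instances of the sequent calculus `T⁻ + cond` (no recursors). -/
inductive Rule : Type
  | id (σ : Ty)
  | ex (Γ : List Ty) (ρ σ : Ty) (Δ : List Ty) (τ : Ty)
  | wk (Γ : List Ty) (σ τ : Ty)
  | cntr (Γ : List Ty) (σ τ : Ty)
  | cut (Γ : List Ty) (σ τ : Ty)
  | left (Γ : List Ty) (ρ σ τ : Ty)
  | right (Γ : List Ty) (σ τ : Ty)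
  | zero
  | succ
  | cond (Γ : List Ty) (τ : Ty)

namespace Rule

/-- The conclusion of a rule instance. -/
def concl : Rule → Sequent
  | id σ => ([σ], σ)
  | ex Γ ρ σ Δ τ => (Γ ++ ρ :: σ :: Δ, τ)
  | wk Γ σ τ => (Γ ++ [σ], τ)
  | cntr Γ σ τ => (Γ ++ [σ], τ)
  | cut Γ _ τ => (Γ, τ)
  | left Γ ρ σ τ => (Γ ++ [Ty.arr ρ σ], τ)
  | right Γ σ τ => (Γ, Ty.arr σ τ)
  | zero => ([], Ty.N)
  | succ => ([Ty.N], Ty.N)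
  | cond Γ τ => (Γ ++ [Ty.N], τ)

/-- The premisses of a rule instance, from left to right. -/
def premises : Rule → List Sequent
  | id _ => []
  | ex Γ ρ σ Δ τ => [(Γ ++ σ :: ρ :: Δ, τ)]
  | wk Γ _ τ => [(Γ, τ)]
  | cntr Γ σ τ => [(Γ ++ [σ, σ], τ)]
  | cut Γ σ τ => [(Γ, σ), (Γ ++ [σ], τ)]
  | left Γ ρ σ τ => [(Γ, ρ), (Γ ++ [σ], τ)]
  | right Γ σ τ => [(Γ ++ [σ], τ)]
  | zero => []
  | succ => []
  | cond Γ τ => [(Γ, τ), (Γ ++ [Ty.N], τ)]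

/-- A rule instance with premisses `S₁, …, Sₖ` and conclusion `S` is a constant of type
`S₁ → ⋯ → Sₖ → S`. -/
def ty (r : Rule) : Ty := arrs (r.premises.map Sequent.ty) r.concl.ty

/-- `r.Ancestor i q p`: the type occurrence at position `q` of the antecedent of the `i`-th premiss
(counted from `0`) is an immediate ancestor of the one at position `p` of the antecedent of the
conclusion. -/
def Ancestor : Rule → ℕ → ℕ → ℕ → Prop
  | id _, _, _, _ => False
  | ex Γ _ _ Δ _, i, q, p => i = 0 ∧
      ((q < Γ.length ∧ p = q) ∨
        (q = Γ.length ∧ p = Γ.length + 1) ∨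
        (q = Γ.length + 1 ∧ p = Γ.length) ∨
        (Γ.length + 2 ≤ q ∧ q < Γ.length + 2 + Δ.length ∧ p = q))
  | wk Γ _ _, i, q, p => i = 0 ∧ q < Γ.length ∧ p = q
  | cntr Γ _ _, i, q, p => i = 0 ∧
      ((q < Γ.length ∧ p = q) ∨ ((q = Γ.length ∨ q = Γ.length + 1) ∧ p = Γ.length))
  | cut Γ _ _, i, q, p => (i = 0 ∨ i = 1) ∧ q < Γ.length ∧ p = q
  | left Γ _ _ _, i, q, p => (i = 0 ∨ i = 1) ∧ q < Γ.length ∧ p = q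
  | right Γ _ _, i, q, p => i = 0 ∧ q < Γ.length ∧ p = q
  | zero, _, _, _ => False
  | succ, _, _, _ => False
  | cond Γ _, i, q, p =>
      ((i = 0 ∨ i = 1) ∧ q < Γ.length ∧ p = q) ∨ (i = 1 ∧ q = Γ.length ∧ p = Γ.length)

/-- Position `p` of the conclusion's antecedent is the principal `N` of a `cond` step. -/
def CondPrincipal : Rule → ℕ → Prop
  | cond Γ _, p => p = Γ.length
  | _, _ => False

end Rule

/-! ### Coterms -/

/-- Node labels of coterms: typed variables, constants, and typed application
(of a function of type `σ → τ` to an argument of type `σ`). -/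
inductive Label : Type
  | var (x : ℕ) (σ : Ty)
  | const (r : Rule)
  | app (σ τ : Ty)

/-- The type of a node. -/
def Label.ty : Label → Ty
  | var _ σ => σ
  | const r => r.ty
  | app _ τ => τ

/-- Possibly infinite binary labelled trees, as partial functions on positions; in an application
node `false` leads to the function and `true` to the argument. -/
abbrev CTree : Type := List Bool → Option Label

namespace CTree

/-- The type required of the function (`false`) or argument (`true`) child of a node. -/
def childTy : Option Label → Bool → Option Ty
  | some (Label.app σ τ), false => some (Ty.arr σ τ)
  | some (Label.app σ _), true => some σ
  | _, _ => none

/-- `t.IsCoterm σ`: the tree `t` is a coterm of type `σ`, i.e. its root has type `σ`, its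
application nodes have exactly two children, of the appropriate types, and its other nodes are
leaves. -/
def IsCoterm (t : CTree) (σ : Ty) : Prop :=
  (t []).map Label.ty = some σ ∧
    ∀ (v : List Bool) (b : Bool), (t (v ++ [b])).map Label.ty = childTy (t v) b

/-- The tree with a single node. -/
def leaf (l : Label) : CTree
  | [] => some l
  | _ :: _ => none

/-- The application `s t`, for `s` of type `σ → τ` and `t` of type `σ`. -/
def app (σ τ : Ty) (s t : CTree) : CTree
  | [] => some (Label.app σ τ)
  | false :: v => s v
  | true :: v => t v

/-- The subtree at a position. -/
def sub (t : CTree) (v : List Bool) : CTree := fun w => t (v ++ w)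

/-- No variable occurs. -/
def Closed (t : CTree) : Prop := ∀ v x σ, t v ≠ some (Label.var x σ)

/-- `apps τ f [(σ₁, x₁), …, (σₙ, xₙ)]` is `f x₁ ⋯ xₙ`, of type `τ`, where `xᵢ` has type `σᵢ` and
`f` has type `σ₁ → ⋯ → σₙ → τ`. -/
def apps (τ : Ty) : CTree → List (Ty × CTree) → CTree
  | f, [] => f
  | f, x :: xs => apps τ (app x.1 (arrs (xs.map Prod.fst) τ) f x.2) xs

end CTree

open CTree

/-- `r.apply [t₁, …, tₖ] xs` is the coterm `r t₁ ⋯ tₖ xs`, for `k` the number of premisses of `r`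
and `xs` a list of typed arguments for the antecedent of the conclusion of `r`. -/
def Rule.apply (r : Rule) (ts : List CTree) (xs : List (Ty × CTree)) : CTree :=
  apps r.concl.2 (leaf (Label.const r)) ((r.premises.map Sequent.ty).zip ts ++ xs)

/-- The types of a list of typed arguments. -/
def tys (xs : List (Ty × CTree)) : List Ty := xs.map Prod.fst

/-- The coterm `0`. -/
def zeroTree : CTree := leaf (Label.const Rule.zero)

/-- The coterm `succ t`. -/
def succTree (t : CTree) : CTree := app Ty.N Ty.N (leaf (Label.const Rule.succ)) t

/-- The reduction rules; lists of arguments may be empty. -/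
inductive Contract : CTree → CTree → Prop
  | id (σ : Ty) (x : CTree) :
      Contract ((Rule.id σ).apply [] [(σ, x)]) x
  | ex (τ : Ty) (t : CTree) (xs ys : List (Ty × CTree)) (x y : Ty × CTree) :
      Contract ((Rule.ex (tys xs) x.1 y.1 (tys ys) τ).apply [t] (xs ++ x :: y :: ys))
        (apps τ t (xs ++ y :: x :: ys))
  | wk (τ : Ty) (t : CTree) (xs : List (Ty × CTree)) (x : Ty × CTree) :
      Contract ((Rule.wk (tys xs) x.1 τ).apply [t] (xs ++ [x])) (apps τ t xs)
  | cntr (τ : Ty) (t : CTree) (xs : List (Ty × CTree)) (x : Ty × CTree) :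
      Contract ((Rule.cntr (tys xs) x.1 τ).apply [t] (xs ++ [x])) (apps τ t (xs ++ [x, x]))
  | cut (σ τ : Ty) (s t : CTree) (xs : List (Ty × CTree)) :
      Contract ((Rule.cut (tys xs) σ τ).apply [s, t] xs) (apps τ t (xs ++ [(σ, apps σ s xs)]))
  | left (ρ σ τ : Ty) (s t : CTree) (xs : List (Ty × CTree)) (y : CTree) :
      Contract ((Rule.left (tys xs) ρ σ τ).apply [s, t] (xs ++ [(Ty.arr ρ σ, y)]))
        (apps τ t (xs ++ [(σ, app ρ σ y (apps ρ s xs))]))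
  | right (τ : Ty) (t : CTree) (xs : List (Ty × CTree)) (x : Ty × CTree) :
      Contract (app x.1 τ ((Rule.right (tys xs) x.1 τ).apply [t] xs) x.2) (apps τ t (xs ++ [x]))
  | cond_zero (τ : Ty) (s t : CTree) (xs : List (Ty × CTree)) :
      Contract ((Rule.cond (tys xs) τ).apply [s, t] (xs ++ [(Ty.N, zeroTree)])) (apps τ s xs)
  | cond_succ (τ : Ty) (s t : CTree) (xs : List (Ty × CTree)) (y : CTree) :
      Contract ((Rule.cond (tys xs) τ).apply [s, t] (xs ++ [(Ty.N, succTree y)]))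
        (apps τ t (xs ++ [(Ty.N, y)]))

/-- One-step reduction: the closure of the reduction rules under contexts. -/
inductive Red : CTree → CTree → Prop
  | contract {s t : CTree} : Contract s t → Red s t
  | app_left {s s' : CTree} (σ τ : Ty) (t : CTree) : Red s s' → Red (app σ τ s t) (app σ τ s' t)
  | app_right {t t' : CTree} (σ τ : Ty) (s : CTree) : Red t t' → Red (app σ τ s t) (app σ τ s t')

namespace CTree

/-- Reduction in finitely many (possibly zero) steps. -/
def Reds : CTree → CTree → Prop := Relation.ReflTransGen Red

/-- No reduction applies. -/
def Normal (t : CTree) : Prop := ∀ t', ¬ Red t t'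

/-- Strong normalisation: there is no infinite sequence of reductions from `t`. -/
def StronglyNormalising (t : CTree) : Prop :=
  ¬ ∃ f : ℕ → CTree, f 0 = t ∧ ∀ n, Red (f n) (f (n + 1))

/-- The set of positions at which `t` has a redex. -/
def redexes (t : CTree) : Set (List Bool) := {v | ∃ u, Contract (t.sub v) u}

end CTree

/-! ### Coderivations -/

/-- Possibly infinite trees of rule instances; the entry `i` of a position leads to the `i`-th
premiss, counted from `0`. -/
abbrev RuleTree : Type := List ℕ → Option Rule

/-- A coderivation of `S`: a possibly infinite tree of rule instances whose root concludes `S` and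
in which the children of a node conclude exactly the premisses of that node. -/
def IsCoderivation (d : RuleTree) (S : Sequent) : Prop :=
  (d []).map Rule.concl = some S ∧
    ∀ (v : List ℕ) (i : ℕ),
      (d (v ++ [i])).map Rule.concl = (d v).bind fun r => r.premises[i]?

namespace RuleTree

/-- The subtree at a position. -/
def sub (d : RuleTree) (v : List ℕ) : RuleTree := fun w => d (v ++ w)

/-- Regularity: there are only finitely many distinct sub-coderivations. -/
def Regular (d : RuleTree) : Prop := {e : RuleTree | ∃ v, d v ≠ none ∧ e = d.sub v}.Finite

/-- The position at depth `n` on the path `b`. -/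
def along (b : ℕ → ℕ) (n : ℕ) : List ℕ := (List.range n).map b

/-- The path `b` is an infinite branch of `d`. -/
def IsBranch (d : RuleTree) (b : ℕ → ℕ) : Prop := ∀ n, d (along b n) ≠ none

/-- From depth `k` on, the occurrences at positions `p n` of the antecedents at depth `n` form an
`N`-thread along the branch `b` that is infinitely often principal for a `cond` step. -/
def IsProgressingThread (d : RuleTree) (b : ℕ → ℕ) (k : ℕ) (p : ℕ → ℕ) : Prop :=
  (∀ n, k ≤ n → ∃ r, d (along b n) = some r ∧ r.concl.1[p n]? = some Ty.N ∧
      r.Ancestor (b n) (p (n + 1)) (p n)) ∧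
    ∀ m, ∃ n, m ≤ n ∧ k ≤ n ∧ ∃ r, d (along b n) = some r ∧ r.CondPrincipal (p n)

/-- Every infinite branch has a progressing thread, which may start anywhere on the branch. -/
def Progressing (d : RuleTree) : Prop :=
  ∀ b, d.IsBranch b → ∃ k p, d.IsProgressingThread b k p

/-- Auxiliary to `toTree`, by recursion on the position. -/
def toTreeAux : List Bool → RuleTree → Option Label
  | [], d => (d []).map fun r =>
      match r.premises with
      | [] => Label.const r
      | [S] => Label.app S.ty r.concl.ty
      | _ :: S' :: _ => Label.app S'.ty r.concl.ty
  | [false], d => (d []).bind fun r =>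
      match r.premises with
      | [] => none
      | [_] => some (Label.const r)
      | S :: S' :: _ => some (Label.app S.ty (Ty.arr S'.ty r.concl.ty))
  | true :: v, d => (d []).bind fun r =>
      match r.premises with
      | [] => none
      | [_] => toTreeAux v (d.sub [0])
      | _ :: _ :: _ => toTreeAux v (d.sub [1])
  | false :: false :: v, d => (d []).bind fun r =>
      match r.premises with
      | _ :: _ :: _ => leaf (Label.const r) v
      | _ => none
  | false :: true :: v, d => (d []).bind fun r =>
      match r.premises with
      | _ :: _ :: _ => toTreeAux v (d.sub [0])
      | _ => none

/-- The coterm of a coderivation; see the three equations below. -/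
def toTree (d : RuleTree) : CTree := fun v => toTreeAux v d

/-- A coderivation that consists of an initial step `r` is the coterm `r`. -/
theorem toTree_nullary {d : RuleTree} {r : Rule} (h : d [] = some r) (hr : r.premises = []) :
    d.toTree = leaf (Label.const r) := by
  funext v
  rcases v with _ | ⟨_ | _, _ | ⟨_ | _, v⟩⟩ <;> simp [toTree, toTreeAux, leaf, h, hr]

/-- A coderivation that concludes with a unary step `r` is the coterm `r s`. -/
theorem toTree_unary {d : RuleTree} {r : Rule} {S : Sequent} (h : d [] = some r)
    (hr : r.premises = [S]) :
    d.toTree = app S.ty r.concl.ty (leaf (Label.const r)) (d.sub [0]).toTree := by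
  funext v
  rcases v with _ | ⟨_ | _, _ | ⟨_ | _, v⟩⟩ <;> simp [toTree, toTreeAux, leaf, app, h, hr]

/-- A coderivation that concludes with a binary step `r` is the coterm `r s s'`. -/
theorem toTree_binary {d : RuleTree} {r : Rule} {S S' : Sequent} (h : d [] = some r)
    (hr : r.premises = [S, S']) :
    d.toTree = app S'.ty r.concl.ty
      (app S.ty (Ty.arr S'.ty r.concl.ty) (leaf (Label.const r)) (d.sub [0]).toTree)
      (d.sub [1]).toTree := by
  funext v
  rcases v with _ | ⟨_ | _, _ | ⟨_ | _, v⟩⟩ <;> simp [toTree, toTreeAux, leaf, app, h, hr]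

end RuleTree

/-- The `CT` coterms of each type: finite applications of regular progressing coderivations,
constants and variables. -/
inductive IsCT : CTree → Ty → Prop
  | var (x : ℕ) (σ : Ty) : IsCT (leaf (Label.var x σ)) σ
  | const (r : Rule) : IsCT (leaf (Label.const r)) r.ty
  | coderivation {d : RuleTree} {S : Sequent} (h : IsCoderivation d S) (hreg : d.Regular)
      (hprog : d.Progressing) : IsCT d.toTree S.ty
  | app {σ τ : Ty} {s t : CTree} (hs : IsCT s (Ty.arr σ τ)) (ht : IsCT t σ) :
      IsCT (app σ τ s t) τ

/-! ### Well-typedness -/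

theorem isCoterm_leaf (l : Label) (h : ∀ σ τ, l ≠ .app σ τ) : IsCoterm (leaf l) l.ty := by
  refine ⟨rfl, fun v b => ?_⟩
  cases v <;> cases l <;> simp_all [leaf, childTy]

theorem isCoterm_app_iff {σ τ ρ : Ty} {s t : CTree} :
    IsCoterm (app σ τ s t) ρ ↔ ρ = τ ∧ IsCoterm s (.arr σ τ) ∧ IsCoterm t σ := by
  constructor
  · rintro ⟨h0, h⟩
    refine ⟨?_, ⟨?_, fun v b => ?_⟩, ?_, fun v b => ?_⟩
    · simpa [app, Label.ty] using h0.symm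
    · simpa [app, childTy] using h [] false
    · simpa [app] using h (false :: v) b
    · simpa [app, childTy] using h [] true
    · simpa [app] using h (true :: v) b
  · rintro ⟨rfl, ⟨a, hs⟩, c, d⟩
    refine ⟨rfl, fun v b => ?_⟩
    rcases v with _ | ⟨_ | _, v⟩
    · cases b <;> simp [app, childTy, a, c]
    · exact hs v b
    · exact d v b

theorem isCoterm_apps_iff {τ : Ty} {xs : List (Ty × CTree)} {f : CTree} :
    IsCoterm (apps τ f xs) τ ↔ IsCoterm f (arrs (tys xs) τ) ∧ ∀ x ∈ xs, IsCoterm x.2 x.1 := by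
  induction xs generalizing f with
  | nil => simp [apps, tys, arrs]
  | cons x xs ih =>
    simp only [apps, ih, isCoterm_app_iff, tys, List.map, arrs, List.mem_cons, forall_eq_or_imp]
    tauto

theorem arrs_append (Γ Δ : List Ty) (τ : Ty) : arrs (Γ ++ Δ) τ = arrs Γ (arrs Δ τ) := by
  induction Γ <;> simp_all [arrs]

theorem apps_ty {τ σ : Ty} {f : CTree} {xs : List (Ty × CTree)} (hx : xs ≠ [])
    (h : IsCoterm (apps τ f xs) σ) : σ = τ := by
  induction xs generalizing f with
  | nil => simp at hx
  | cons x xs ih =>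
    rcases xs with _ | ⟨y, ys⟩
    · simp [apps, isCoterm_app_iff, arrs] at h; exact h.1
    · exact ih (by simp) h

theorem IsCoterm.unique {t : CTree} {σ τ} (h : IsCoterm t σ) (h' : IsCoterm t τ) : σ = τ := by
  have := h.1.symm.trans h'.1; simpa using this

theorem Contract.isCoterm {s t : CTree} (h : Contract s t) {σ} (hs : IsCoterm s σ) :
    IsCoterm t σ := by
  cases h with
  | id ρ x => 
    obtain rfl := apps_ty (by simp [Rule.premises]) hs
    simp [Rule.apply, Rule.premises, Rule.concl, isCoterm_apps_iff] at hs ⊢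
    exact hs.2
  | right τ t xs x =>
    simp only [isCoterm_app_iff] at hs
    obtain ⟨rfl, h1, h2⟩ := hs
    simp [Rule.apply, Rule.premises, Rule.concl, isCoterm_apps_iff, Sequent.ty, tys] at h1 ⊢
    simp_all
    grind
  | _ => 
    obtain rfl := apps_ty (by simp [Rule.premises]) hs
    simp [Rule.apply, Rule.premises, Rule.concl, isCoterm_apps_iff, Sequent.ty, tys, arrs_append, arrs, succTree, or_imp, forall_and] at hs ⊢
    simp_all [isCoterm_app_iff, isCoterm_apps_iff, tys]

/-- Reduction leads from coterms of type `σ` to coterms of type `σ`. -/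
theorem Red.isCoterm {s t : CTree} (h : Red s t) {σ} (hs : IsCoterm s σ) :
    IsCoterm t σ := by
  induction h generalizing σ with
  | contract h => exact h.isCoterm hs
  | app_left _ _ _ _ ih => simp only [isCoterm_app_iff] at *; grind
  | app_right _ _ _ _ ih => simp only [isCoterm_app_iff] at *; grind

theorem IsCoderivation.sub {d S r i} (h : IsCoderivation d S) (hr : d [] = some r) {S'} (hS : r.premises[i]? = some S') :
   IsCoderivation (d.sub [i]) S' := by
  refine ⟨?_, fun v j => ?_⟩
  · have := h.2 [] i
    simpa [hr, hS, RuleTree.sub] using this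
  · simpa [RuleTree.sub] using h.2 (i :: v) j

/-- The coterm of a coderivation of `S` is a coterm of the type of `S`. -/
theorem IsCoderivation.isCoterm {d S} (h : IsCoderivation d S) : IsCoterm d.toTree S.ty := by
  have key : ∀ d S, IsCoderivation d S → (d.toTree []).map Label.ty = some S.ty := by
    intro d S h
    have h0 := h.1
    rw [Option.map_eq_some_iff] at h0
    obtain ⟨r, hr, rfl⟩ := h0
    have : r.premises = [] ∨ (∃ S, r.premises = [S]) ∨ ∃ S S', r.premises = [S, S'] := by
      cases r <;> simp [Rule.premises]
    rcases this with h' | ⟨_, h'⟩ | ⟨_, _, h'⟩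
    · rw [RuleTree.toTree_nullary hr h']; simp [leaf, Label.ty, Rule.ty, h', arrs]
    · rw [RuleTree.toTree_unary hr h']; simp [app, Label.ty]
    · rw [RuleTree.toTree_binary hr h']; simp [app, Label.ty]
  refine ⟨key _ _ h, fun v b => ?_⟩
  induction hn : v.length using Nat.strong_induction_on generalizing v d S with
  | _ n ih =>
  have h0 := h.1
  rw [Option.map_eq_some_iff] at h0
  obtain ⟨r, hr, rfl⟩ := h0
  have hc : IsCoterm (leaf (Label.const r)) r.ty := isCoterm_leaf _ (by simp)
  have : r.premises = [] ∨ (∃ S, r.premises = [S]) ∨ ∃ S S', r.premises = [S, S'] := by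
    cases r <;> simp [Rule.premises]
  rcases this with h' | ⟨S, h'⟩ | ⟨S, S', h'⟩
  · rw [RuleTree.toTree_nullary hr h']; exact hc.2 v b
  · rw [RuleTree.toTree_unary hr h']
    have h1 := h.sub hr (i := 0) (S' := S) (by simp [h'])
    rcases v with _ | ⟨_ | _, v⟩
    · cases b
      · simp [app, childTy, hc.1, Rule.ty, h', arrs]
      · simp [app, childTy, key _ _ h1]
    · simpa [app] using hc.2 v b
    · exact ih _ (by simp [← hn]) h1 v rfl
  · rw [RuleTree.toTree_binary hr h']
    have h1 := h.sub hr (i := 0) (S' := S) (by simp [h'])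
    have h2 := h.sub hr (i := 1) (S' := S') (by simp [h'])
    rcases v with _ | ⟨_ | _, _ | ⟨_ | _, v⟩⟩
    · cases b
      · simp [app, childTy, Label.ty]
      · simp [app, childTy, key _ _ h2]
    · cases b
      · simp [app, childTy, hc.1, Rule.ty, h', arrs]
      · simp [app, childTy, key _ _ h1]
    · simpa [app] using hc.2 v b
    · exact ih _ (by simp only [← hn, List.length_cons]; omega) h1 v rfl
    · exact ih _ (by simp [← hn]) h2 [] rfl
    · exact ih _ (by simp [← hn]) h2 (false :: v) rfl
    · exact ih _ (by simp [← hn]) h2 (true :: v) rfl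

/-- A `CT` coterm of type `σ` is a coterm of type `σ`. -/
theorem IsCT.isCoterm {t σ} (h : IsCT t σ) : IsCoterm t σ := by
  induction h with
  | var x σ => exact isCoterm_leaf _ (by simp)
  | const r => exact isCoterm_leaf _ (by simp)
  | coderivation h _ _ => exact h.isCoterm
  | app _ _ h1 h2 => exact isCoterm_app_iff.2 ⟨rfl, h1, h2⟩

end CircularT

namespace CircularT

open CTree

/-! ### Applications to lists of arguments -/

/-! The proof joins Tait's computability method to the infinite descent supplied by progressing
threads. At type `N`, computability `Comp` is accessibility for `Below`, which passes both to
reducts and from a successor to its argument; at arrow types it is the usual logical clause.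
Computable trees are strongly normalising (`comp_aux`), so existence reduces to `IsCT.comp`.

The core is local (`exists_premise_not_comp`): if a rule constant, applied to strongly normalising
premiss coterms and computable arguments, is not computable, then some premiss coterm fails on
computable arguments too. Values linked by ancestry never rise in `Below`, and they drop strictly at
a principal `cond`. Iterated in a coderivation, failure traces an infinite branch, and its
progressing thread yields an impossible descent (`IsCoderivation.comp_of_sn`).

The iteration requires every sub-coderivation to have a strongly normalising coterm. This is
immediate when there are no redexes, for then all these coterms are normal. Finitely many redexes
have bounded depth, so a finite top part of the coderivation can be peeled off
(`comp_of_redexes_length_lt`): it consists of constants, computable by `comp_const`, applied to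
coderivations that are eventually free of redexes.

For uniqueness, redexes overlap only by lying inside arguments of one another, which gives local
confluence (`Red.join`); strong normalisation then gives unique normal forms as in Newman's lemma.
-/

theorem app_inj {σ τ σ' τ' : Ty} {s t s' t' : CTree}
    (h : CTree.app σ τ s t = CTree.app σ' τ' s' t') : σ = σ' ∧ τ = τ' ∧ s = s' ∧ t = t' := by
  have h0 := congrFun h []
  simp only [CTree.app, Option.some.injEq, Label.app.injEq] at h0
  exact ⟨h0.1, h0.2, funext fun v => congrFun h (false :: v),
    funext fun v => congrFun h (true :: v)⟩

/-- Labels of leaves. -/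
def Label.Atomic (a : Label) : Prop := ∀ σ τ, a ≠ Label.app σ τ

theorem Label.atomic_const (r : Rule) : (Label.const r).Atomic := fun _ _ => by simp

theorem Label.atomic_var (x : ℕ) (σ : Ty) : (Label.var x σ).Atomic := fun _ _ => by simp

theorem leaf_ne_app {a : Label} (ha : a.Atomic) {σ τ : Ty} {s t : CTree} :
    leaf a ≠ CTree.app σ τ s t := fun h => by
  have h0 := congrFun h []
  exact ha σ τ (by simpa [CTree.app, leaf] using h0)

theorem leaf_inj {a b : Label} (h : leaf a = leaf b) : a = b := by
  simpa [leaf] using congrFun h []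

theorem apps_append (τ : Ty) (f : CTree) (l m : List (Ty × CTree)) :
    apps τ f (l ++ m) = apps τ (apps (arrs (tys m) τ) f l) m := by
  induction l generalizing f with
  | nil => rfl
  | cons x l ih =>
    simp only [List.cons_append, apps, ih, List.map_append, arrs_append]
    rfl

theorem apps_concat (τ : Ty) (f : CTree) (l : List (Ty × CTree)) (x : Ty × CTree) :
    apps τ f (l ++ [x]) = CTree.app x.1 τ (apps (Ty.arr x.1 τ) f l) x.2 :=
  apps_append τ f l [x]

/-- The last argument sits at the root, so the induction removes arguments from the right. With no
arguments, `τ` leaves no trace in the tree, hence the guard on the third conclusion. -/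
theorem apps_leaf_inj {a b : Label} (ha : a.Atomic) (hb : b.Atomic) {τ τ' : Ty}
    {l l' : List (Ty × CTree)} (h : apps τ (leaf a) l = apps τ' (leaf b) l') :
    a = b ∧ l = l' ∧ (l ≠ [] → τ = τ') := by
  induction l using List.reverseRecOn generalizing τ τ' l' with
  | nil =>
    rcases l'.eq_nil_or_concat with rfl | ⟨l', y, rfl⟩
    · exact ⟨leaf_inj h, rfl, by simp⟩
    · rw [List.concat_eq_append, apps_concat] at h
      exact (leaf_ne_app ha h).elim
  | append_singleton l x ih =>
    rcases l'.eq_nil_or_concat with rfl | ⟨l', y, rfl⟩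
    · rw [apps_concat] at h
      exact (leaf_ne_app hb h.symm).elim
    · rw [List.concat_eq_append, apps_concat, apps_concat] at h
      obtain ⟨h1, h2, h3, h4⟩ := app_inj h
      obtain ⟨h5, h6, -⟩ := ih h3
      exact ⟨h5, by rw [h6, List.concat_eq_append, Prod.ext h1 h4], fun _ => h2⟩

theorem succTree_eq (y : CTree) :
    succTree y = apps Ty.N (leaf (Label.const Rule.succ)) [(Ty.N, y)] := rfl

/-! ### Redexes as constants with their arguments -/

/-- The number of arguments of the constant `r` in a redex. -/
def Rule.arity : Rule → ℕ
  | right Γ _ _ => Γ.length + 2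
  | r => r.premises.length + r.concl.1.length

/-- The type of a redex with head `r`. -/
def Rule.res : Rule → Ty
  | right _ _ τ => τ
  | r => r.concl.2

/-- `HeadStep r l u`: the constant `r` applied to the arguments `l` contracts to `u`. -/
inductive HeadStep : Rule → List (Ty × CTree) → CTree → Prop
  | id (σ : Ty) (x : CTree) : HeadStep (Rule.id σ) [(σ, x)] x
  | ex (τ α : Ty) (t : CTree) (xs ys : List (Ty × CTree)) (x y : Ty × CTree)
      (hα : α = arrs (tys xs ++ y.1 :: x.1 :: tys ys) τ) :
      HeadStep (Rule.ex (tys xs) x.1 y.1 (tys ys) τ) ((α, t) :: (xs ++ x :: y :: ys))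
        (apps τ t (xs ++ y :: x :: ys))
  | wk (τ α : Ty) (t : CTree) (xs : List (Ty × CTree)) (x : Ty × CTree)
      (hα : α = arrs (tys xs) τ) :
      HeadStep (Rule.wk (tys xs) x.1 τ) ((α, t) :: (xs ++ [x])) (apps τ t xs)
  | cntr (τ α : Ty) (t : CTree) (xs : List (Ty × CTree)) (x : Ty × CTree)
      (hα : α = arrs (tys xs ++ [x.1, x.1]) τ) :
      HeadStep (Rule.cntr (tys xs) x.1 τ) ((α, t) :: (xs ++ [x])) (apps τ t (xs ++ [x, x]))
  | cut (σ τ α β : Ty) (s t : CTree) (xs : List (Ty × CTree))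
      (hα : α = arrs (tys xs) σ) (hβ : β = arrs (tys xs ++ [σ]) τ) :
      HeadStep (Rule.cut (tys xs) σ τ) ((α, s) :: (β, t) :: xs)
        (apps τ t (xs ++ [(σ, apps σ s xs)]))
  | left (ρ σ τ α β : Ty) (s t : CTree) (xs : List (Ty × CTree)) (y : CTree)
      (hα : α = arrs (tys xs) ρ) (hβ : β = arrs (tys xs ++ [σ]) τ) :
      HeadStep (Rule.left (tys xs) ρ σ τ) ((α, s) :: (β, t) :: (xs ++ [(Ty.arr ρ σ, y)]))
        (apps τ t (xs ++ [(σ, CTree.app ρ σ y (apps ρ s xs))]))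
  | right (τ α : Ty) (t : CTree) (xs : List (Ty × CTree)) (x : Ty × CTree)
      (hα : α = arrs (tys xs ++ [x.1]) τ) :
      HeadStep (Rule.right (tys xs) x.1 τ) ((α, t) :: (xs ++ [x])) (apps τ t (xs ++ [x]))
  | cond_zero (τ α β : Ty) (s t : CTree) (xs : List (Ty × CTree))
      (hα : α = arrs (tys xs) τ) (hβ : β = arrs (tys xs ++ [Ty.N]) τ) :
      HeadStep (Rule.cond (tys xs) τ) ((α, s) :: (β, t) :: (xs ++ [(Ty.N, zeroTree)]))
        (apps τ s xs)
  | cond_succ (τ α β : Ty) (s t : CTree) (xs : List (Ty × CTree)) (y : CTree)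
      (hα : α = arrs (tys xs) τ) (hβ : β = arrs (tys xs ++ [Ty.N]) τ) :
      HeadStep (Rule.cond (tys xs) τ) ((α, s) :: (β, t) :: (xs ++ [(Ty.N, succTree y)]))
        (apps τ t (xs ++ [(Ty.N, y)]))

/-- This brings all redexes to one shape in which premiss coterms and sequent arguments form a
single list. For `right` the consumed argument lies outside `Rule.apply`, which accounts for the
special values of `Rule.arity` and `Rule.res`. -/
theorem contract_iff {s u : CTree} :
    Contract s u ↔ ∃ r l, s = apps r.res (leaf (Label.const r)) l ∧ HeadStep r l u := by
  constructor
  · rintro (⟨σ, x⟩ | ⟨τ, t, xs, ys, x, y⟩ | ⟨τ, t, xs, x⟩ | ⟨τ, t, xs, x⟩ | ⟨σ, τ, s, t, xs⟩ |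
      ⟨ρ, σ, τ, s, t, xs, y⟩ | ⟨τ, t, xs, x⟩ | ⟨τ, s, t, xs⟩ | ⟨τ, s, t, xs, y⟩)
    · exact ⟨_, _, rfl, .id σ _⟩
    · exact ⟨_, _, rfl, .ex τ _ t xs ys x y rfl⟩
    · exact ⟨_, _, rfl, .wk τ _ t xs x rfl⟩
    · exact ⟨_, _, rfl, .cntr τ _ t xs x rfl⟩
    · exact ⟨_, _, rfl, .cut σ τ _ _ s t xs rfl rfl⟩
    · exact ⟨_, _, rfl, .left ρ σ τ _ _ s t xs y rfl rfl⟩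
    · exact ⟨Rule.right (tys xs) x.1 τ, _, (apps_concat τ _ ((arrs (tys xs ++ [x.1]) τ, t) :: xs) x).symm,
        .right τ _ t xs x rfl⟩
    · exact ⟨_, _, rfl, .cond_zero τ _ _ s t xs rfl rfl⟩
    · exact ⟨_, _, rfl, .cond_succ τ _ _ s t xs y rfl rfl⟩
  · rintro ⟨r, l, rfl, h⟩
    cases h with
    | id σ x => exact .id σ _
    | ex τ α t xs ys x y hα => subst hα; exact .ex τ t xs ys x y
    | wk τ α t xs x hα => subst hα; exact .wk τ t xs x
    | cntr τ α t xs x hα => subst hα; exact .cntr τ t xs x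
    | cut σ τ α β s t xs hα hβ => subst hα hβ; exact .cut σ τ s t xs
    | left ρ σ τ α β s t xs y hα hβ => subst hα hβ; exact .left ρ σ τ s t xs y
    | right τ α t xs x hα =>
      subst hα
      have := apps_concat τ (leaf (Label.const (Rule.right (tys xs) x.1 τ)))
        ((arrs (tys xs ++ [x.1]) τ, t) :: xs) x
      rw [List.cons_append] at this
      simp only [Rule.res]
      rw [this]
      exact .right τ t xs x
    | cond_zero τ α β s t xs hα hβ => subst hα hβ; exact .cond_zero τ s t xs
    | cond_succ τ α β s t xs y hα hβ => subst hα hβ; exact .cond_succ τ s t xs y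

theorem HeadStep.length_eq {r : Rule} {l : List (Ty × CTree)} {u : CTree} (h : HeadStep r l u) :
    l.length = r.arity := by
  cases h <;> simp [Rule.arity, Rule.premises, Rule.concl, tys] <;> omega

theorem zeroTree_ne_succTree (y : CTree) : zeroTree ≠ succTree y :=
  leaf_ne_app (Label.atomic_const _)

theorem HeadStep.unique {r : Rule} {l : List (Ty × CTree)} {u u' : CTree} (h : HeadStep r l u)
    (h' : HeadStep r l u') : u = u' := by
  -- Rule and argument list are replaced by fresh indices with equations, so that both steps can be
  -- analysed by cases.
  have key : ∀ r' l', HeadStep r' l' u' → r = r' → l = l' → u = u' := by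
    clear h'
    intro r' l' h' hr hl
    cases h <;> cases h' <;> simp only [reduceCtorEq, Rule.id.injEq, Rule.ex.injEq, Rule.wk.injEq,
      Rule.cntr.injEq, Rule.cut.injEq, Rule.left.injEq, Rule.right.injEq, Rule.cond.injEq] at hr
    case id.id => simp_all
    case ex.ex =>
      have := congrArg List.length hr.1
      simp only [tys, List.length_map] at this
      simp only [List.cons.injEq, Prod.mk.injEq] at hl
      obtain ⟨h1, h2⟩ := List.append_inj hl.2 this
      simp_all
    case cond_zero.cond_succ =>
      simp [zeroTree_ne_succTree] at hl
    case cond_succ.cond_zero =>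
      simp [(zeroTree_ne_succTree _).symm] at hl
    case cond_succ.cond_succ =>
      simp only [List.cons.injEq, Prod.mk.injEq] at hl
      have := List.append_inj' hl.2.2 rfl
      simp [succTree] at this
      have h3 := app_inj this.2
      simp_all
    all_goals
      simp at hl
      simp_all
  exact key r l h' rfl rfl

/-- Head and arguments can be read off the tree, so a contraction at the root forces a constant with
exactly its arity of arguments. Root contractions are excluded below by counting arguments. -/
theorem Contract.shape {s u : CTree} (h : Contract s u) {a : Label} (ha : a.Atomic) {τ : Ty}
    {l : List (Ty × CTree)} (hs : s = apps τ (leaf a) l) :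
    ∃ r, a = Label.const r ∧ l.length = r.arity ∧ HeadStep r l u := by
  obtain ⟨r, l', h1, h2⟩ := contract_iff.1 h
  obtain ⟨rfl, rfl, -⟩ := apps_leaf_inj ha (Label.atomic_const r) (hs.symm.trans h1)
  exact ⟨r, rfl, h2.length_eq, h2⟩

theorem HeadStep.contract {r : Rule} {l : List (Ty × CTree)} {u : CTree} (h : HeadStep r l u) :
    Contract (apps r.res (leaf (Label.const r)) l) u :=
  contract_iff.2 ⟨r, l, rfl, h⟩

theorem Contract.unique {s u u' : CTree} (h : Contract s u) (h' : Contract s u') : u = u' := by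
  obtain ⟨r, l, hs, h1⟩ := contract_iff.1 h
  obtain ⟨r', hr, -, h2⟩ := h'.shape (Label.atomic_const r) hs
  cases hr
  exact h1.unique h2

/-! ### Reduction of arguments -/

theorem red_cases {t u : CTree} (h : Red t u) :
    Contract t u ∨ ∃ σ τ f x, t = CTree.app σ τ f x ∧
      ((∃ f', Red f f' ∧ u = CTree.app σ τ f' x) ∨ ∃ x', Red x x' ∧ u = CTree.app σ τ f x') := by
  cases h with
  | contract h => exact .inl h
  | app_left σ τ t h => exact .inr ⟨σ, τ, _, _, rfl, .inl ⟨_, h, rfl⟩⟩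
  | app_right σ τ t h => exact .inr ⟨σ, τ, _, _, rfl, .inr ⟨_, h, rfl⟩⟩

theorem red_app_cases {σ τ : Ty} {f x u : CTree} (h : Red (CTree.app σ τ f x) u) :
    Contract (CTree.app σ τ f x) u ∨ (∃ f', Red f f' ∧ u = CTree.app σ τ f' x) ∨
      ∃ x', Red x x' ∧ u = CTree.app σ τ f x' := by
  rcases red_cases h with h | ⟨σ', τ', f', x', h1, h2⟩
  · exact .inl h
  · obtain ⟨rfl, rfl, rfl, rfl⟩ := app_inj h1
    exact .inr h2

theorem not_red_leaf_const {r : Rule} (hr : 0 < r.arity) (u : CTree) :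
    ¬ Red (leaf (Label.const r)) u := fun h => by
  rcases red_cases h with h | ⟨σ, τ, f, x, h, -⟩
  · obtain ⟨r', h1, h2, -⟩ := h.shape (Label.atomic_const r) (τ := Ty.N) (l := []) rfl
    cases h1
    simp at h2
    omega
  · exact leaf_ne_app (Label.atomic_const r) h

theorem not_red_zeroTree (u : CTree) : ¬ Red zeroTree u := fun h => by
  rcases red_cases h with h | ⟨σ, τ, f, x, h, -⟩
  · obtain ⟨r', h1, -, h2⟩ := h.shape (Label.atomic_const _) (τ := Ty.N) (l := []) rfl
    cases h1
    cases h2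
  · exact leaf_ne_app (Label.atomic_const _) h

theorem red_succTree {y u : CTree} (h : Red (succTree y) u) : ∃ y', Red y y' ∧ u = succTree y' := by
  rcases red_app_cases h with h | ⟨f', h, -⟩ | h
  · obtain ⟨r', h1, -, h2⟩ := h.shape (Label.atomic_const _) (succTree_eq y)
    cases h1
    cases h2
  · exact (not_red_leaf_const (by simp [Rule.arity, Rule.concl]) _ h).elim
  · exact h

theorem reds_zeroTree {u : CTree} (h : Reds zeroTree u) : u = zeroTree := by
  induction h with
  | refl => rfl
  | tail _ h ih => subst ih; exact (not_red_zeroTree _ h).elim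

theorem reds_succTree {y u : CTree} (h : Reds (succTree y) u) :
    ∃ y', Reds y y' ∧ u = succTree y' := by
  induction h with
  | refl => exact ⟨y, .refl, rfl⟩
  | tail _ h ih =>
    obtain ⟨y', h1, rfl⟩ := ih
    obtain ⟨y'', h2, rfl⟩ := red_succTree h
    exact ⟨y'', h1.tail h2, rfl⟩

theorem reds_app {σ τ : Ty} {f f' x x' : CTree} (hf : Reds f f') (hx : Reds x x') :
    Reds (CTree.app σ τ f x) (CTree.app σ τ f' x') :=
  .trans (Relation.ReflTransGen.lift (fun g => CTree.app σ τ g x) (fun _ _ h => Red.app_left σ τ x h) _ _ hf)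
    (Relation.ReflTransGen.lift (fun y => CTree.app σ τ f' y) (fun _ _ h => Red.app_right σ τ f' h) _ _
      hx)

/-- Componentwise reduction of typed arguments in finitely many steps. -/
abbrev ArgsReds : List (Ty × CTree) → List (Ty × CTree) → Prop :=
  List.Forall₂ fun x y => x.1 = y.1 ∧ Reds x.2 y.2

theorem ArgsReds.refl (l : List (Ty × CTree)) : ArgsReds l l := by
  induction l with
  | nil => exact .nil
  | cons x l ih => exact .cons ⟨rfl, .refl⟩ ih

theorem ArgsReds.append_left {l m k : List (Ty × CTree)} (h : ArgsReds (l ++ m) k) :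
    ∃ l' m', k = l' ++ m' ∧ ArgsReds l l' ∧ ArgsReds m m' := by
  induction l generalizing k with
  | nil => exact ⟨[], k, rfl, .nil, h⟩
  | cons x l ih =>
    cases h with
    | cons h1 h2 =>
      obtain ⟨l', m', rfl, h3, h4⟩ := ih h2
      exact ⟨_ :: l', m', rfl, .cons h1 h3, h4⟩

theorem ArgsReds.append {l l' m m' : List (Ty × CTree)} (h : ArgsReds l l') (h' : ArgsReds m m') :
    ArgsReds (l ++ m) (l' ++ m') :=
  List.rel_append h h'

theorem ArgsReds.tys_eq {l l' : List (Ty × CTree)} (h : ArgsReds l l') : tys l = tys l' := by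
  induction h with
  | nil => rfl
  | cons h1 _ ih => simp_all [tys]

theorem ArgsReds.trans {l m k : List (Ty × CTree)} (h : ArgsReds l m) (h' : ArgsReds m k) :
    ArgsReds l k := by
  induction h generalizing k with
  | nil => exact h'
  | cons h1 _ ih =>
    cases h' with
    | cons h2 h3 => exact .cons ⟨h1.1.trans h2.1, h1.2.trans h2.2⟩ (ih h3)

theorem reds_apps (τ : Ty) {f f' : CTree} {l l' : List (Ty × CTree)} (hf : Reds f f')
    (hl : ArgsReds l l') : Reds (apps τ f l) (apps τ f' l') := by
  induction hl generalizing f f' with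
  | nil => exact hf
  | @cons x y l l' h1 h2 ih =>
    have h3 := ArgsReds.tys_eq h2
    simp only [tys] at h3
    simp only [apps, ← h1.1, ← h3]
    exact ih (reds_app hf h1.2)

/-- The left-hand sides are linear, and the only patterns on arguments, zero and successor, are
stable under reduction. The step therefore survives, and its contractum follows by reducing every
copy of the changed arguments. -/
theorem HeadStep.argsReds {r : Rule} {l l' : List (Ty × CTree)} {u : CTree} (h : HeadStep r l u)
    (hl : ArgsReds l l') : ∃ u', HeadStep r l' u' ∧ Reds u u' := by
  cases h with
  | id σ x =>
    obtain _ | ⟨⟨h1, h2⟩, ⟨⟩⟩ := hl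
    rename_i b
    obtain ⟨σ', x'⟩ := b
    cases h1
    exact ⟨_, .id _ _, h2⟩
  | ex τ α t xs ys x y hα =>
    obtain _ | @⟨_, b, _, _, ⟨h1, h2⟩, h3⟩ := hl
    obtain ⟨α', t'⟩ := b
    cases h1
    obtain ⟨xs', m, rfl, h4, _ | ⟨⟨h5, h6⟩, _ | ⟨⟨h7, h8⟩, h9⟩⟩⟩ := ArgsReds.append_left h3
    rw [h5, h7, ArgsReds.tys_eq h4, ArgsReds.tys_eq h9]
    simp only [h5, h7, ArgsReds.tys_eq h4, ArgsReds.tys_eq h9] at hα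
    exact ⟨_, .ex _ _ _ _ _ _ _ hα, reds_apps _ h2 (ArgsReds.append h4 (.cons ⟨h7, h8⟩ (.cons ⟨h5, h6⟩ h9)))⟩
  | wk τ α t xs x hα =>
    obtain _ | @⟨_, b, _, _, ⟨h1, h2⟩, h3⟩ := hl
    obtain ⟨α', t'⟩ := b
    cases h1
    obtain ⟨xs', m, rfl, h4, _ | ⟨⟨h5, h6⟩, ⟨⟩⟩⟩ := ArgsReds.append_left h3
    rw [h5, ArgsReds.tys_eq h4]
    simp only [ArgsReds.tys_eq h4] at hα
    exact ⟨_, .wk _ _ _ _ _ hα, reds_apps _ h2 h4⟩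
  | cntr τ α t xs x hα =>
    obtain _ | @⟨_, b, _, _, ⟨h1, h2⟩, h3⟩ := hl
    obtain ⟨α', t'⟩ := b
    cases h1
    obtain ⟨xs', m, rfl, h4, _ | ⟨⟨h5, h6⟩, ⟨⟩⟩⟩ := ArgsReds.append_left h3
    rw [h5, ArgsReds.tys_eq h4]
    simp only [h5, ArgsReds.tys_eq h4] at hα
    exact ⟨_, .cntr _ _ _ _ _ hα,
      reds_apps _ h2 (ArgsReds.append h4 (.cons ⟨h5, h6⟩ (.cons ⟨h5, h6⟩ .nil)))⟩
  | right τ α t xs x hα =>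
    obtain _ | @⟨_, b, _, _, ⟨h1, h2⟩, h3⟩ := hl
    obtain ⟨α', t'⟩ := b
    cases h1
    obtain ⟨xs', m, rfl, h4, _ | ⟨⟨h5, h6⟩, ⟨⟩⟩⟩ := ArgsReds.append_left h3
    rw [h5, ArgsReds.tys_eq h4]
    simp only [h5, ArgsReds.tys_eq h4] at hα
    exact ⟨_, .right _ _ _ _ _ hα, reds_apps _ h2 (ArgsReds.append h4 (.cons ⟨h5, h6⟩ .nil))⟩
  | cut σ τ α β s t xs hα hβ =>
    obtain _ | @⟨_, b, _, _, ⟨h1, h2⟩, _ | @⟨_, b', _, _, ⟨h1', h2'⟩, h4⟩⟩ := hl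
    obtain ⟨α', s'⟩ := b
    obtain ⟨β', t'⟩ := b'
    cases h1
    cases h1'
    rw [ArgsReds.tys_eq h4] at *
    exact ⟨_, .cut _ _ _ _ _ _ _ hα hβ,
      reds_apps _ h2' (ArgsReds.append h4 (.cons ⟨rfl, reds_apps _ h2 h4⟩ .nil))⟩
  | left ρ σ τ α β s t xs y hα hβ =>
    obtain _ | @⟨_, b, _, _, ⟨h1, h2⟩, _ | @⟨_, b', _, _, ⟨h1', h2'⟩, h3⟩⟩ := hl
    obtain ⟨α', s'⟩ := b
    obtain ⟨β', t'⟩ := b'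
    cases h1
    cases h1'
    obtain ⟨xs', m, rfl, h4, _ | ⟨⟨h5, h6⟩, ⟨⟩⟩⟩ := ArgsReds.append_left h3
    rename_i b
    obtain ⟨σ', y'⟩ := b
    cases h5
    rw [ArgsReds.tys_eq h4] at *
    exact ⟨_, .left _ _ _ _ _ _ _ _ _ hα hβ,
      reds_apps _ h2' (ArgsReds.append h4 (.cons ⟨rfl, reds_app h6 (reds_apps _ h2 h4)⟩ .nil))⟩
  | cond_zero τ α β s t xs hα hβ =>
    obtain _ | @⟨_, b, _, _, ⟨h1, h2⟩, _ | @⟨_, b', _, _, ⟨h1', h2'⟩, h3⟩⟩ := hl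
    obtain ⟨α', s'⟩ := b
    obtain ⟨β', t'⟩ := b'
    cases h1
    cases h1'
    obtain ⟨xs', m, rfl, h4, _ | ⟨⟨h5, h6⟩, ⟨⟩⟩⟩ := ArgsReds.append_left h3
    rename_i b
    obtain ⟨σ', y'⟩ := b
    cases h5
    cases reds_zeroTree h6
    rw [ArgsReds.tys_eq h4] at *
    exact ⟨_, .cond_zero _ _ _ _ _ _ hα hβ, reds_apps _ h2 h4⟩
  | cond_succ τ α β s t xs y hα hβ =>
    obtain _ | @⟨_, b, _, _, ⟨h1, h2⟩, _ | @⟨_, b', _, _, ⟨h1', h2'⟩, h3⟩⟩ := hl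
    obtain ⟨α', s'⟩ := b
    obtain ⟨β', t'⟩ := b'
    cases h1
    cases h1'
    obtain ⟨xs', m, rfl, h4, _ | ⟨⟨h5, h6⟩, ⟨⟩⟩⟩ := ArgsReds.append_left h3
    rename_i b
    obtain ⟨σ', y'⟩ := b
    cases h5
    obtain ⟨y'', h7, rfl⟩ := reds_succTree h6
    rw [ArgsReds.tys_eq h4] at *
    exact ⟨_, .cond_succ _ _ _ _ _ _ _ hα hβ, reds_apps _ h2' (ArgsReds.append h4 (.cons ⟨rfl, h7⟩ .nil))⟩

/-- A single reduction step in one of the arguments. -/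
inductive ArgsRed : List (Ty × CTree) → List (Ty × CTree) → Prop
  | head {σ : Ty} {x x' : CTree} (l : List (Ty × CTree)) (h : Red x x') :
      ArgsRed ((σ, x) :: l) ((σ, x') :: l)
  | tail (x : Ty × CTree) {l l' : List (Ty × CTree)} (h : ArgsRed l l') :
      ArgsRed (x :: l) (x :: l')

theorem ArgsRed.argsReds {l l' : List (Ty × CTree)} (h : ArgsRed l l') : ArgsReds l l' := by
  induction h with
  | head l h => exact .cons ⟨rfl, .single h⟩ (ArgsReds.refl l)
  | tail x _ ih => exact .cons ⟨rfl, .refl⟩ ih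

theorem ArgsRed.append {l l' : List (Ty × CTree)} (h : ArgsRed l l') (m : List (Ty × CTree)) :
    ArgsRed (l ++ m) (l' ++ m) := by
  induction h with
  | head l h => exact .head _ h
  | tail x _ ih => exact .tail x ih

theorem argsRed_append_head (m : List (Ty × CTree)) {σ : Ty} {x x' : CTree} (h : Red x x') :
    ArgsRed (m ++ [(σ, x)]) (m ++ [(σ, x')]) := by
  induction m with
  | nil => exact .head _ h
  | cons y m ih => exact .tail y ih

/-- A constant with at most as many arguments as it has in a redex reduces at the root or in an
argument. -/
theorem red_apps_cases {r : Rule} {τ : Ty} {l : List (Ty × CTree)} {u : CTree}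
    (hl : l.length ≤ r.arity) (h : Red (apps τ (leaf (Label.const r)) l) u) :
    Contract (apps τ (leaf (Label.const r)) l) u ∨
      ∃ l', ArgsRed l l' ∧ u = apps τ (leaf (Label.const r)) l' := by
  induction l using List.reverseRecOn generalizing τ u with
  | nil =>
    rcases red_cases h with h | ⟨σ, τ, f, x, h, -⟩
    · exact .inl h
    · exact (leaf_ne_app (Label.atomic_const _) h).elim
  | append_singleton l x ih =>
    have hlt : l.length < r.arity := by simp at hl; omega
    rw [apps_concat] at h ⊢
    rcases red_app_cases h with h | ⟨f', hf, rfl⟩ | ⟨x', hx, rfl⟩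
    · exact .inl h
    · rcases ih hlt.le hf with hf | ⟨l', hl', rfl⟩
      -- A contraction of the function part would need the full arity, but that part has one
      -- argument fewer.
      · obtain ⟨r', h1, h2, -⟩ := hf.shape (Label.atomic_const _) rfl
        cases h1
        omega
      · exact .inr ⟨l' ++ [x], hl'.append _, (apps_concat _ _ _ _).symm⟩
    · exact .inr ⟨l ++ [(x.1, x')], argsRed_append_head l hx, (apps_concat _ _ _ (x.1, x')).symm⟩

/-! ### Local confluence and uniqueness of normal forms -/

/-- Strong normalisation as accessibility. -/
abbrev SN (t : CTree) : Prop := Acc (fun y x => Red x y) t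

theorem Contract.join {t u v : CTree} (h : Contract t u) (h' : Red t v) :
    ∃ w, Reds u w ∧ Reds v w := by
  obtain ⟨r, l, rfl, h1⟩ := contract_iff.1 h
  rcases red_apps_cases h1.length_eq.le h' with h' | ⟨l', h2, rfl⟩
  · exact ⟨u, .refl, by rw [h.unique h']; exact .refl⟩
  · obtain ⟨w, h3, h4⟩ := h1.argsReds h2.argsReds
    exact ⟨w, h4, .single (.contract h3.contract)⟩

theorem Red.join {t u v : CTree} (h : Red t u) (h' : Red t v) : ∃ w, Reds u w ∧ Reds v w := by
  induction h generalizing v with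
  | contract h => exact h.join h'
  | app_left σ τ x h ih =>
    rcases red_app_cases h' with h' | ⟨f', hf, rfl⟩ | ⟨x', hx, rfl⟩
    · obtain ⟨w, h1, h2⟩ := h'.join (.app_left σ τ x h)
      exact ⟨w, h2, h1⟩
    · obtain ⟨w, h1, h2⟩ := ih hf
      exact ⟨_, reds_app h1 .refl, reds_app h2 .refl⟩
    · exact ⟨_, .single (.app_right σ τ _ hx), .single (.app_left σ τ _ h)⟩
  | app_right σ τ f h ih =>
    rcases red_app_cases h' with h' | ⟨f', hf, rfl⟩ | ⟨x', hx, rfl⟩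
    · obtain ⟨w, h1, h2⟩ := h'.join (.app_right σ τ f h)
      exact ⟨w, h2, h1⟩
    · exact ⟨_, .single (.app_left σ τ _ hf), .single (.app_right σ τ _ h)⟩
    · obtain ⟨w, h1, h2⟩ := ih hx
      exact ⟨_, reds_app .refl h1, reds_app .refl h2⟩

theorem reds_normal {t u : CTree} (ht : t.Normal) (h : Reds t u) : u = t := by
  rcases h.cases_head with h | ⟨v, h, -⟩
  · exact h.symm
  · exact (ht v h).elim

theorem SN.reds {t u : CTree} (h : SN t) (h' : Reds t u) : SN u := by
  induction h' with
  | refl => exact h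
  | tail _ h ih => exact ih.inv h

theorem ArgsReds.sn {l l' : List (Ty × CTree)} (h : ArgsReds l l') (hl : ∀ x ∈ l, SN x.2) :
    ∀ x ∈ l', SN x.2 := by
  induction h with
  | nil => exact hl
  | cons h1 _ ih =>
    obtain ⟨h2, h3⟩ := List.forall_mem_cons.1 hl
    exact List.forall_mem_cons.2 ⟨h2.reds h1.2, ih h3⟩

theorem SN.exists_normal {t : CTree} (h : SN t) : ∃ u, Reds t u ∧ u.Normal := by
  induction h with
  | intro t _ ih =>
    by_cases hn : t.Normal
    · exact ⟨t, .refl, hn⟩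
    · simp only [CTree.Normal, not_forall, not_not] at hn
      obtain ⟨t', ht'⟩ := hn
      obtain ⟨u, h1, h2⟩ := ih t' ht'
      exact ⟨u, h1.head ht', h2⟩

/-- Newman's argument: the two first steps are joined, the common reduct is normalised, and both
normal forms are compared with the result by induction. -/
theorem SN.normal_unique {t : CTree} (h : SN t) {u v : CTree} (hu : Reds t u) (hun : u.Normal)
    (hv : Reds t v) (hvn : v.Normal) : u = v := by
  induction h generalizing u v with
  | intro t ht ih =>
    rcases hu.cases_head with rfl | ⟨u1, hu1, hu⟩
    · exact (reds_normal hun hv).symm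
    rcases hv.cases_head with rfl | ⟨v1, hv1, hv⟩
    · exact (hvn _ hu1).elim
    obtain ⟨w, h1, h2⟩ := hu1.join hv1
    obtain ⟨n, h3, h4⟩ := (SN.reds ⟨t, ht⟩ (h1.head hu1)).exists_normal
    rw [ih u1 hu1 hu hun (h1.trans h3) h4, ih v1 hv1 hv hvn (h2.trans h3) h4]

theorem SN.stronglyNormalising {t : CTree} (h : SN t) : t.StronglyNormalising := by
  rintro ⟨f, rfl, hf⟩
  exact not_acc_iff_exists_descending_chain.2 ⟨f, rfl, hf⟩ h

/-! ### Computability -/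

/-- Reducts and, for a successor, its argument. -/
def Below (y x : CTree) : Prop := Red x y ∨ x = succTree y

/-- Computability of trees, by recursion on the type. -/
def Comp : Ty → CTree → Prop
  | Ty.N, t => Acc Below t
  | Ty.arr σ τ, t => ∀ s, Comp σ s → Comp τ (CTree.app σ τ t s)

/-- Applications of type `ρ` to which no further argument gives a redex or a successor. -/
def Neutral (ρ : Ty) (t : CTree) : Prop :=
  ∃ a l, a.Atomic ∧ (∀ r, a = Label.const r → r ≠ Rule.succ ∧ r.arity ≤ l.length) ∧
    t = apps ρ (leaf a) l

theorem SN.of_app {σ τ : Ty} {f x : CTree} (h : SN (CTree.app σ τ f x)) : SN f := by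
  generalize ht : CTree.app σ τ f x = t at h
  induction h generalizing f with
  | intro t _ ih =>
    subst ht
    exact ⟨_, fun f' hf => ih _ (.app_left σ τ x hf) rfl⟩

theorem Neutral.app {σ τ : Ty} {f : CTree} (h : Neutral (Ty.arr σ τ) f) (x : CTree) :
    Neutral τ (CTree.app σ τ f x) := by
  obtain ⟨a, l, ha, hr, rfl⟩ := h
  refine ⟨a, l ++ [(σ, x)], ha, fun r h => ⟨(hr r h).1, ?_⟩, (apps_concat τ _ l (σ, x)).symm⟩
  have := (hr r h).2
  simp
  omega

theorem Neutral.not_contract_app {σ τ : Ty} {f : CTree} (h : Neutral (Ty.arr σ τ) f)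
    (x u : CTree) : ¬ Contract (CTree.app σ τ f x) u := fun hc => by
  obtain ⟨a, l, ha, hr, rfl⟩ := h
  obtain ⟨r, h1, h2, -⟩ := hc.shape ha (apps_concat τ _ l (σ, x)).symm
  have := (hr r h1).2
  simp at h2
  omega

theorem Neutral.ne_succTree {t : CTree} (h : Neutral Ty.N t) (y : CTree) : t ≠ succTree y := by
  rintro rfl
  obtain ⟨a, l, ha, hr, h⟩ := h
  rw [succTree_eq] at h
  obtain ⟨h1, -, -⟩ := apps_leaf_inj (Label.atomic_const _) ha h
  exact (hr _ h1.symm).1 rfl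

theorem neutral_var (x : ℕ) (σ : Ty) : Neutral σ (leaf (Label.var x σ)) :=
  ⟨_, [], Label.atomic_var x σ, fun r h => by simp at h, rfl⟩

theorem not_red_var (x : ℕ) (σ : Ty) (u : CTree) : ¬ Red (leaf (Label.var x σ)) u := fun h => by
  rcases red_cases h with h | ⟨_, _, _, _, h, -⟩
  · obtain ⟨r', h1, -⟩ := h.shape (Label.atomic_var x σ) (τ := Ty.N) (l := []) rfl
    cases h1
  · exact leaf_ne_app (Label.atomic_var x σ) h

/-- Girard's three conditions, proved simultaneously. At an arrow type, the first follows by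
application to a variable, which is computable by the third condition on the domain. At `N`,
neutrality excludes successors, so only reducts matter in the third. -/
theorem comp_aux (σ : Ty) :
    (∀ t, Comp σ t → SN t) ∧ (∀ t t', Comp σ t → Red t t' → Comp σ t') ∧
      ∀ t, Neutral σ t → (∀ t', Red t t' → Comp σ t') → Comp σ t := by
  induction σ with
  | N =>
    refine ⟨fun t h => ?_, fun t t' h h' => Acc.inv h (.inl h'), fun t h h' => ?_⟩
    · exact Subrelation.accessible (h₁ := fun h => Or.inl h) h
    · refine ⟨t, fun y hy => ?_⟩
      rcases hy with hy | hy
      · exact h' y hy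
      · exact (h.ne_succTree y hy).elim
  | arr σ τ ihσ ihτ =>
    refine ⟨fun t h => ?_, fun t t' h h' s hs => ?_, fun t h h' s hs => ?_⟩
    · exact (ihτ.1 _ (h _ (ihσ.2.2 (leaf (Label.var 0 σ)) (neutral_var 0 σ)
        fun t' h => (not_red_var 0 σ t' h).elim))).of_app
    · exact ihτ.2.1 _ _ (h s hs) (.app_left σ τ s h')
    -- The argument can reduce as well, hence an inner induction on its strong normalisation.
    · induction ihσ.1 s hs with
      | intro s _ ih =>
        refine ihτ.2.2 _ (h.app s) fun u hu => ?_
        rcases red_app_cases hu with hu | ⟨f, hf, rfl⟩ | ⟨x, hx, rfl⟩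
        · exact (h.not_contract_app s u hu).elim
        · exact h' f hf s hs
        · exact ih x hx (ihσ.2.1 s x hs hx)

theorem Comp.sn {σ : Ty} {t : CTree} (h : Comp σ t) : SN t := (comp_aux σ).1 t h

theorem Comp.reds {σ : Ty} {t t' : CTree} (h : Comp σ t) (h' : Reds t t') : Comp σ t' := by
  induction h' with
  | refl => exact h
  | tail _ h' ih => exact (comp_aux σ).2.1 _ _ ih h'

theorem Neutral.comp {σ : Ty} {t : CTree} (h : Neutral σ t) (h' : ∀ t', Red t t' → Comp σ t') :
    Comp σ t := (comp_aux σ).2.2 t h h'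

theorem comp_var (x : ℕ) (σ : Ty) : Comp σ (leaf (Label.var x σ)) :=
  (neutral_var x σ).comp fun t' h => (not_red_var x σ t' h).elim

/-- Computability of typed arguments. -/
def CompArgs (xs : List (Ty × CTree)) : Prop := ∀ x ∈ xs, Comp x.1 x.2

theorem CompArgs.append {xs ys : List (Ty × CTree)} (hx : CompArgs xs) (hy : CompArgs ys) :
    CompArgs (xs ++ ys) := fun x h => by
  rcases List.mem_append.1 h with h | h
  · exact hx x h
  · exact hy x h

theorem CompArgs.of_append {xs ys : List (Ty × CTree)} (h : CompArgs (xs ++ ys)) :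
    CompArgs xs ∧ CompArgs ys :=
  ⟨fun x hx => h x (List.mem_append_left _ hx), fun x hx => h x (List.mem_append_right _ hx)⟩

theorem compArgs_singleton {x : Ty × CTree} (h : Comp x.1 x.2) : CompArgs [x] := by
  simpa [CompArgs] using h

theorem comp_apps {τ : Ty} {f : CTree} {xs : List (Ty × CTree)} (hf : Comp (arrs (tys xs) τ) f)
    (hxs : CompArgs xs) : Comp τ (apps τ f xs) := by
  induction xs generalizing f with
  | nil => exact hf
  | cons x xs ih =>
    exact ih (hf x.2 (hxs x (by simp))) fun y hy => hxs y (by simp [hy])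

theorem comp_of_apps {Γ : List Ty} {τ : Ty} {f : CTree}
    (h : ∀ xs, tys xs = Γ → CompArgs xs → Comp τ (apps τ f xs)) : Comp (arrs Γ τ) f := by
  induction Γ generalizing f with
  | nil => exact h [] rfl (by simp [CompArgs])
  | cons σ Γ ih =>
    intro s hs
    refine ih fun xs hxs hc => ?_
    subst hxs
    exact h ((σ, s) :: xs) rfl fun x hx => by
      rcases List.mem_cons.1 hx with rfl | hx
      · exact hs
      · exact hc x hx

/-! ### Head expansion -/

theorem acc_argsRed {l : List (Ty × CTree)} (h : ∀ x ∈ l, SN x.2) :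
    Acc (fun m l => ArgsRed l m) l := by
  induction l with
  | nil => exact ⟨_, fun _ h => by cases h⟩
  | cons x l ih =>
    obtain ⟨σ, x⟩ := x
    have hx : SN x := h (σ, x) (by simp)
    have hl := ih fun y hy => h y (by simp [hy])
    clear h ih
    induction hx generalizing l with
    | intro x hx ihx =>
      induction hl with
      | intro l hl ihl =>
        refine ⟨_, fun m hm => ?_⟩
        cases hm with
        | head _ h => exact ihx _ h l ⟨l, hl⟩
        | tail _ h => exact ihl _ h

/-- Head expansion, contraposed. At full arity the application is neutral, so it is computable once
its reducts are. By induction on reductions of the arguments, failure must come from a contraction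
at the root after some of them. -/
theorem exists_headStep {r : Rule} {ρ : Ty} {l : List (Ty × CTree)} (hlen : l.length = r.arity)
    (hr : r ≠ Rule.succ) (hl : ∀ x ∈ l, SN x.2)
    (hn : ¬ Comp ρ (apps ρ (leaf (Label.const r)) l)) :
    ∃ l' u, ArgsReds l l' ∧ HeadStep r l' u ∧ ¬ Comp ρ u := by
  by_contra! H
  refine hn ?_
  clear hn
  induction acc_argsRed hl with
  | intro l _ ih =>
    have hneu : Neutral ρ (apps ρ (leaf (Label.const r)) l) :=
      ⟨_, l, Label.atomic_const r, fun r' h => by cases h; exact ⟨hr, hlen.ge⟩, rfl⟩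
    refine hneu.comp fun u hu => ?_
    rcases red_apps_cases hlen.le hu with hu | ⟨l', h1, rfl⟩
    · obtain ⟨r', h1, -, h2⟩ := hu.shape (Label.atomic_const r) rfl
      cases h1
      exact H l u (ArgsReds.refl l) h2
    · have h2 := h1.argsReds
      have h3 := h2.length_eq
      exact ih l' h1 (by omega) (ArgsReds.sn h2 hl) fun m u hm => H m u (ArgsReds.trans h2 hm)

/-- The contraction is already available before the arguments reduce. The failing contractum found
by `exists_headStep` is a reduct of `u`, and computability is preserved by reduction. -/
theorem not_comp_contractum {r : Rule} {ρ : Ty} {l : List (Ty × CTree)} {u : CTree}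
    (h : HeadStep r l u) (hr : ∀ Γ τ, r ≠ Rule.cond Γ τ) (hl : ∀ x ∈ l, SN x.2)
    (hn : ¬ Comp ρ (apps ρ (leaf (Label.const r)) l)) : ¬ Comp ρ u := fun hu => by
  obtain ⟨l', u', h1, h2, h3⟩ := exists_headStep h.length_eq (by rintro rfl; cases h) hl hn
  obtain ⟨v, h4, h5⟩ := h.argsReds h1
  obtain rfl := h2.unique h4
  exact h3 (hu.reds h5)

theorem headStep_cond {Γ : List Ty} {τ α β γ : Ty} {s t n u : CTree} {xs : List (Ty × CTree)}
    (h : HeadStep (Rule.cond Γ τ) ((α, s) :: (β, t) :: (xs ++ [(γ, n)])) u) :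
    (n = zeroTree ∧ u = apps τ s xs) ∨
      ∃ y, n = succTree y ∧ u = apps τ t (xs ++ [(Ty.N, y)]) := by
  generalize hr : Rule.cond Γ τ = r at h
  generalize hl : (α, s) :: (β, t) :: (xs ++ [(γ, n)]) = l at h
  cases h <;> cases hr
  · simp at hl
    simp_all
  · simp at hl
    exact .inr ⟨_, hl.2.2.2.2, by simp_all⟩

theorem Below.of_reds {x y : CTree} (h : Reds x y) : Relation.ReflTransGen Below y x := by
  induction h with
  | refl => exact .refl
  | tail _ h ih => exact ih.head (.inl h)

theorem comp_of_reflTransGen {x y : CTree} (h : Comp Ty.N x)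
    (hy : Relation.ReflTransGen Below y x) : Comp Ty.N y := by
  induction hy using Relation.ReflTransGen.head_induction_on with
  | refl => exact h
  | head h' _ ih => exact Acc.inv ih h'

/-- Values along an ancestry relation at a step `r` into its `i`-th premiss do not increase, and
decrease if a `cond` step is principal. -/
def Descends (r : Rule) (i : ℕ) (xs xs' : List (Ty × CTree)) : Prop :=
  ∀ q p, r.Ancestor i q p → ∀ y, xs'[q]? = some y →
    ∃ x, xs[p]? = some x ∧ Relation.ReflTransGen Below y.2 x.2 ∧
      (r.CondPrincipal p → Relation.TransGen Below y.2 x.2)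

/-- Local soundness of the rules, contraposed. Premiss coterms are assumed only strongly
normalising, because their computability is what is at stake along a branch. The initial rules
cannot fail; the others hand the failure to a premiss through their contractum. -/
theorem exists_premise_not_comp {r : Rule} {ts : List CTree} {xs : List (Ty × CTree)}
    (hlen : ts.length = r.premises.length) (hts : ∀ t ∈ ts, SN t) (hty : tys xs = r.concl.1)
    (hxs : CompArgs xs) (hn : ¬ Comp r.concl.2 (r.apply ts xs)) :
    ∃ i S t xs', r.premises[i]? = some S ∧ ts[i]? = some t ∧ tys xs' = S.1 ∧ CompArgs xs' ∧
      ¬ Comp S.2 (apps S.2 t xs') ∧ Descends r i xs xs' := by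
  have hsn : ∀ x ∈ xs, SN x.2 := fun x hx => (hxs x hx).sn
  cases r with
  | id σ =>
    obtain rfl := List.length_eq_zero_iff.1 hlen
    obtain ⟨⟨σ, x⟩, rfl, rfl⟩ := List.map_eq_singleton_iff.1 hty
    exact (not_comp_contractum (.id σ x) (by simp) hsn hn (hxs _ List.mem_cons_self)).elim
  | zero =>
    obtain rfl := List.length_eq_zero_iff.1 hlen
    obtain rfl := List.map_eq_nil_iff.1 hty
    obtain ⟨l', u, -, h, -⟩ := exists_headStep (by simp [Rule.arity, Rule.premises, Rule.concl])
      (by simp) hsn hn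
    cases h
  | succ =>
    obtain rfl := List.length_eq_zero_iff.1 hlen
    obtain ⟨⟨σ, x⟩, rfl, rfl⟩ := List.map_eq_singleton_iff.1 hty
    have hx : Comp Ty.N x := hxs _ List.mem_cons_self
    refine (hn ?_).elim
    -- A successor is not neutral and is treated directly: its reducts are successors of reducts,
    -- and its argument is accessible.
    change Acc Below (succTree x)
    clear hn hxs hsn hlen hts hty
    induction hx with
    | intro x h ih =>
      refine ⟨_, fun y hy => ?_⟩
      rcases hy with hy | hy
      · obtain ⟨y', h1, rfl⟩ := red_succTree hy
        exact ih y' (.inl h1)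
      · obtain ⟨-, -, -, rfl⟩ := app_inj hy
        exact ⟨x, h⟩
  | ex Γ ρ σ Δ τ =>
    obtain ⟨t, rfl⟩ := List.length_eq_one_iff.1 hlen
    obtain ⟨xs, l, rfl, rfl, h⟩ := List.map_eq_append_iff.1 hty
    obtain ⟨x, l, rfl, rfl, h'⟩ := List.map_eq_cons_iff.1 h
    obtain ⟨y, ys, rfl, rfl, rfl⟩ := List.map_eq_cons_iff.1 h'
    obtain ⟨h1, h2⟩ := hxs.of_append
    refine ⟨0, _, t, xs ++ y :: x :: ys, rfl, rfl, by simp [tys], ?_, ?_, ?_⟩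
    · refine h1.append fun z hz => h2 z ?_
      simp at hz ⊢
      tauto
    · refine not_comp_contractum (.ex τ _ t xs ys x y rfl) (by simp) ?_ hn
      exact List.forall_mem_cons.2 ⟨hts t (by simp), hsn⟩
    · rintro q p ⟨-, h⟩ z hz
      refine ⟨z, ?_, .refl, False.elim⟩
      simp only [List.length_map] at h
      rcases h with ⟨h, rfl⟩ | ⟨rfl, rfl⟩ | ⟨rfl, rfl⟩ | ⟨h, h', rfl⟩
      · rw [List.getElem?_append_left h] at hz ⊢
        exact hz
      · simpa using hz
      · simpa using hz
      · rw [List.getElem?_append_right (by omega)] at hz ⊢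
        obtain ⟨k, hk⟩ : ∃ k, p - xs.length = k + 2 := ⟨p - xs.length - 2, by omega⟩
        rw [hk] at hz ⊢
        simpa using hz
  | wk Γ σ τ =>
    obtain ⟨t, rfl⟩ := List.length_eq_one_iff.1 hlen
    obtain ⟨xs, l, rfl, rfl, h⟩ := List.map_eq_append_iff.1 hty
    obtain ⟨x, rfl, rfl⟩ := List.map_eq_singleton_iff.1 h
    refine ⟨0, _, t, xs, rfl, rfl, rfl, hxs.of_append.1, ?_, ?_⟩
    · refine not_comp_contractum (.wk τ _ t xs x rfl) (by simp) ?_ hn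
      exact List.forall_mem_cons.2 ⟨hts t (by simp), hsn⟩
    · rintro q p ⟨-, h, rfl⟩ z hz
      rw [List.length_map] at h
      exact ⟨z, by rwa [List.getElem?_append_left h], .refl, False.elim⟩
  | cntr Γ σ τ =>
    obtain ⟨t, rfl⟩ := List.length_eq_one_iff.1 hlen
    obtain ⟨xs, l, rfl, rfl, h⟩ := List.map_eq_append_iff.1 hty
    obtain ⟨x, rfl, rfl⟩ := List.map_eq_singleton_iff.1 h
    obtain ⟨h1, h2⟩ := hxs.of_append
    refine ⟨0, _, t, xs ++ [x, x], rfl, rfl, by simp [tys], ?_, ?_, ?_⟩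
    · exact h1.append (h2.append h2)
    · refine not_comp_contractum (.cntr τ _ t xs x rfl) (by simp) ?_ hn
      exact List.forall_mem_cons.2 ⟨hts t (by simp), hsn⟩
    · rintro q p ⟨-, h⟩ z hz
      refine ⟨z, ?_, .refl, False.elim⟩
      simp only [List.length_map] at h
      rcases h with ⟨h, rfl⟩ | ⟨rfl | rfl, rfl⟩
      · rw [List.getElem?_append_left h] at hz ⊢
        exact hz
      · simpa using hz
      · simpa using hz
  | right Γ σ τ =>
    obtain ⟨t, rfl⟩ := List.length_eq_one_iff.1 hlen
    obtain rfl := hty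
    -- Failure at an arrow type supplies the computable argument that completes the redex; it
    -- becomes the value of the new antecedent type.
    have : ¬ ∀ x, Comp σ x → Comp τ (CTree.app σ τ ((Rule.right (tys xs) σ τ).apply [t] xs) x) :=
      hn
    push Not at this
    obtain ⟨x, hx, hn⟩ := this
    refine ⟨0, _, t, xs ++ [(σ, x)], rfl, rfl, by simp [tys], ?_, ?_, ?_⟩
    · exact hxs.append (compArgs_singleton hx)
    · refine not_comp_contractum (.right τ _ t xs (σ, x) rfl) (by simp) ?_ ?_
      · refine List.forall_mem_cons.2 ⟨hts t (by simp), fun y hy => ?_⟩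
        exact (hxs.append (compArgs_singleton (x := (σ, x)) hx) y hy).sn
      · rw [← List.cons_append, apps_concat]
        exact hn
    · rintro q p ⟨-, h, rfl⟩ z hz
      simp only [tys, List.length_map] at h
      rw [List.getElem?_append_left h] at hz
      exact ⟨z, hz, .refl, False.elim⟩
  | cut Γ σ τ =>
    obtain ⟨s, t, rfl⟩ := List.length_eq_two.1 hlen
    obtain rfl := hty
    -- If the cut value is computable it serves as an argument of the right premiss; otherwise the
    -- left premiss already fails.
    by_cases hs : Comp σ (apps σ s xs)
    · refine ⟨1, _, t, xs ++ [(σ, apps σ s xs)], rfl, rfl, by simp [tys], ?_, ?_, ?_⟩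
      · exact hxs.append (compArgs_singleton hs)
      · refine not_comp_contractum (.cut σ τ _ _ s t xs rfl rfl) (by simp) ?_ hn
        exact List.forall_mem_cons.2 ⟨hts s (by simp),
          List.forall_mem_cons.2 ⟨hts t (by simp), hsn⟩⟩
      · rintro q p ⟨-, h, rfl⟩ z hz
        simp only [tys, List.length_map] at h
        rw [List.getElem?_append_left h] at hz
        exact ⟨z, hz, .refl, False.elim⟩
    · refine ⟨0, _, s, xs, rfl, rfl, rfl, hxs, hs, ?_⟩
      rintro q p ⟨-, h, rfl⟩ z hz
      exact ⟨z, hz, .refl, False.elim⟩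
  | left Γ ρ σ τ =>
    obtain ⟨s, t, rfl⟩ := List.length_eq_two.1 hlen
    obtain ⟨xs, l, rfl, rfl, h⟩ := List.map_eq_append_iff.1 hty
    obtain ⟨⟨α, y⟩, rfl, hα⟩ := List.map_eq_singleton_iff.1 h
    cases hα
    obtain ⟨h1, h2⟩ := hxs.of_append
    have hy : Comp (Ty.arr ρ σ) y := h2 _ List.mem_cons_self
    by_cases hs : Comp ρ (apps ρ s xs)
    · refine ⟨1, _, t, xs ++ [(σ, CTree.app ρ σ y (apps ρ s xs))], rfl, rfl, by simp [tys],
        ?_, ?_, ?_⟩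
      · exact h1.append (compArgs_singleton (hy _ hs))
      · refine not_comp_contractum (.left ρ σ τ _ _ s t xs y rfl rfl) (by simp) ?_ hn
        exact List.forall_mem_cons.2 ⟨hts s (by simp),
          List.forall_mem_cons.2 ⟨hts t (by simp), hsn⟩⟩
      · rintro q p ⟨-, h, rfl⟩ z hz
        rw [List.length_map] at h
        rw [List.getElem?_append_left h] at hz
        exact ⟨z, by rwa [List.getElem?_append_left h], .refl, False.elim⟩
    · refine ⟨0, _, s, xs, rfl, rfl, rfl, h1, hs, ?_⟩
      rintro q p ⟨-, h, rfl⟩ z hz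
      rw [List.length_map] at h
      exact ⟨z, by rwa [List.getElem?_append_left h], .refl, False.elim⟩
  | cond Γ τ =>
    obtain ⟨s, t, rfl⟩ := List.length_eq_two.1 hlen
    obtain ⟨xs, l, rfl, rfl, h⟩ := List.map_eq_append_iff.1 hty
    obtain ⟨⟨α, n⟩, rfl, hα⟩ := List.map_eq_singleton_iff.1 h
    cases hα
    obtain ⟨h1, h2⟩ := hxs.of_append
    have hcn : Comp Ty.N n := h2 _ List.mem_cons_self
    -- The value `n` need not yet be zero or a successor, so the arguments are reduced until a
    -- `cond` contraction fires.
    obtain ⟨l', u, h3, h4, h5⟩ := exists_headStep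
      (r := Rule.cond (tys xs) τ)
      (l := (arrs (tys xs) τ, s) :: (arrs (tys xs ++ [Ty.N]) τ, t) :: (xs ++ [(Ty.N, n)]))
      (by simp [Rule.arity, Rule.premises, Rule.concl, tys]; omega) (by simp)
      (List.forall_mem_cons.2 ⟨hts s (by simp), List.forall_mem_cons.2 ⟨hts t (by simp), hsn⟩⟩) hn
    obtain _ | @⟨_, ⟨α', s'⟩, _, _, ⟨-, hs⟩, _ | @⟨_, ⟨β', t'⟩, _, _, ⟨-, ht⟩, h6⟩⟩ := h3
    obtain ⟨xs', m, rfl, h7, _ | @⟨_, ⟨γ', n'⟩, _, _, ⟨-, hn'⟩, ⟨⟩⟩⟩ := ArgsReds.append_left h6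
    rcases headStep_cond h4 with ⟨rfl, rfl⟩ | ⟨y, rfl, rfl⟩
    -- Failure is carried back from the reduced premiss and arguments to `s` and `xs` themselves, so
    -- the trace stays inside the original coderivation.
    · refine ⟨0, _, s, xs, rfl, rfl, rfl, h1, fun h => h5 (h.reds (reds_apps τ hs h7)), ?_⟩
      rintro q p (⟨-, h, rfl⟩ | ⟨h, -⟩) z hz
      · rw [List.length_map] at h
        refine ⟨z, by rwa [List.getElem?_append_left h], .refl, fun h' => ?_⟩
        simp only [Rule.CondPrincipal, List.length_map] at h'
        omega
      · omega
    -- The strict drop: `n` reduces to the successor of `y`, and passing to `y` is one further step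
    -- of `Below`.
    · have hy : Relation.TransGen Below y n := .head' (.inr rfl) (Below.of_reds hn')
      refine ⟨1, _, t, xs ++ [(Ty.N, y)], rfl, rfl, by simp [tys], ?_, fun h => h5 (h.reds ?_), ?_⟩
      · exact h1.append (compArgs_singleton (comp_of_reflTransGen hcn hy.to_reflTransGen))
      · exact reds_apps τ ht (ArgsReds.append h7 (.cons ⟨rfl, .refl⟩ .nil))
      · rintro q p (⟨-, h, rfl⟩ | ⟨-, rfl, rfl⟩) z hz
        · rw [List.length_map] at h
          rw [List.getElem?_append_left h] at hz
          refine ⟨z, by rwa [List.getElem?_append_left h], .refl, fun h' => ?_⟩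
          simp only [Rule.CondPrincipal, List.length_map] at h'
          omega
        · simp at hz
          subst hz
          exact ⟨(Ty.N, n), by simp, hy.to_reflTransGen, fun _ => hy⟩

/-! ### Computability of constants -/

/-- One use of the local lemma suffices: here the premiss coterms are themselves computable
arguments, so none of them can fail. -/
theorem comp_const (r : Rule) : Comp r.ty (leaf (Label.const r)) := by
  rw [Rule.ty, Sequent.ty, ← arrs_append]
  refine comp_of_apps fun l hl hc => ?_
  obtain ⟨l, xs, rfl, h1, h2⟩ := List.map_eq_append_iff.1 hl
  obtain ⟨h3, h4⟩ := hc.of_append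
  have hzip : l = (r.premises.map Sequent.ty).zip (l.map Prod.snd) := by
    rw [← h1, List.zip_map', List.map_id']
  by_contra hn
  rw [hzip] at hn
  obtain ⟨i, S, t, xs', h5, h6, h7, h8, h9, -⟩ := exists_premise_not_comp (r := r)
    (ts := l.map Prod.snd) (by simpa using congrArg List.length h1)
    (by
      intro t ht
      obtain ⟨x, hx, rfl⟩ := List.mem_map.1 ht
      exact (h3 x hx).sn) h2 h4 hn
  refine h9 (comp_apps ?_ h8)
  rw [h7]
  rw [List.getElem?_map, Option.map_eq_some_iff] at h6
  obtain ⟨x, h6, rfl⟩ := h6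
  have h10 : x.1 = S.ty := by
    have := congrArg (fun m => m[i]?) h1
    simpa [h6, h5] using this
  have := h3 x (List.mem_of_getElem? h6)
  rwa [h10] at this

/-! ### Computability of coderivations -/

theorem toTree_eq_apps {d : RuleTree} {r : Rule} (h : d [] = some r) :
    d.toTree = apps r.concl.ty (leaf (Label.const r)) ((r.premises.map Sequent.ty).zip
      ((List.range r.premises.length).map fun i => (d.sub [i]).toTree)) := by
  have : r.premises = [] ∨ (∃ S, r.premises = [S]) ∨ ∃ S S', r.premises = [S, S'] := by
    cases r <;> simp [Rule.premises]
  rcases this with h' | ⟨S, h'⟩ | ⟨S, S', h'⟩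
  · rw [RuleTree.toTree_nullary h h', h']
    rfl
  · rw [RuleTree.toTree_unary h h', h']
    rfl
  · rw [RuleTree.toTree_binary h h', h']
    rfl

theorem RuleTree.sub_sub (d : RuleTree) (v w : List ℕ) : (d.sub v).sub w = d.sub (v ++ w) := by
  funext u
  simp [RuleTree.sub]

theorem RuleTree.along_succ (b : ℕ → ℕ) (n : ℕ) : along b (n + 1) = along b n ++ [b n] := by
  simp [along, List.range_succ]

/-- A coderivation node with computable arguments whose application is not computable. -/
structure Failure (d : RuleTree) where
  pos : List ℕ
  rule : Rule
  args : List (Ty × CTree)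
  rule_eq : d pos = some rule
  tys_eq : tys args = rule.concl.1
  comp : CompArgs args
  not_comp : ¬ Comp rule.concl.2 (apps rule.concl.2 (d.sub pos).toTree args)

theorem Failure.exists_next {d : RuleTree} {S : Sequent} (hd : IsCoderivation d S)
    (hsn : ∀ v, d v ≠ none → SN (d.sub v).toTree) (F : Failure d) :
    ∃ (i : ℕ) (G : Failure d), G.pos = F.pos ++ [i] ∧ Descends F.rule i F.args G.args := by
  have hchild : ∀ i S', F.rule.premises[i]? = some S' →
      ∃ r, d (F.pos ++ [i]) = some r ∧ r.concl = S' := fun i S' h => by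
    have := hd.2 F.pos i
    rw [F.rule_eq, Option.bind_some, h, Option.map_eq_some_iff] at this
    exact this
  have hn := F.not_comp
  -- The node's premiss coterms and the arguments are merged into the single list expected by the
  -- local lemma.
  rw [toTree_eq_apps (d := d.sub F.pos) (r := F.rule) (by simp [RuleTree.sub, F.rule_eq]),
    Sequent.ty, ← F.tys_eq, ← apps_append] at hn
  obtain ⟨i, S', t, xs', h1, h2, h3, h4, h5, h6⟩ := exists_premise_not_comp (r := F.rule)
    (ts := (List.range F.rule.premises.length).map fun i => ((d.sub F.pos).sub [i]).toTree)
    (by simp)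
    (by
      intro t ht
      obtain ⟨i, hi, rfl⟩ := List.mem_map.1 ht
      rw [List.mem_range] at hi
      obtain ⟨r, hr, -⟩ := hchild i _ (List.getElem?_eq_getElem hi)
      rw [RuleTree.sub_sub]
      exact hsn _ (by simp [hr])) F.tys_eq F.comp hn
  obtain ⟨r, hr, rfl⟩ := hchild i S' h1
  rw [List.getElem?_map, Option.map_eq_some_iff] at h2
  obtain ⟨j, h2, rfl⟩ := h2
  obtain ⟨_, rfl⟩ := List.getElem?_eq_some_iff.1 h2
  rw [List.getElem_range, RuleTree.sub_sub] at h5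
  exact ⟨i, ⟨F.pos ++ [i], r, xs', hr, h3, h4, h5⟩, rfl, h6⟩

/-- Weak steps compose with the next strict one, giving descent in the transitive closure, for which
accessibility is retained. -/
theorem not_descending_of_acc {f : ℕ → CTree} {k : ℕ} (hacc : Acc Below (f k))
    (hle : ∀ n, k ≤ n → Relation.ReflTransGen Below (f (n + 1)) (f n))
    (hlt : ∀ m, ∃ n, m ≤ n ∧ k ≤ n ∧ Relation.TransGen Below (f (n + 1)) (f n)) : False := by
  have hmono : ∀ m n, k ≤ m → m ≤ n → Relation.ReflTransGen Below (f n) (f m) := by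
    intro m n hm hmn
    induction n, hmn using Nat.le_induction with
    | base => exact .refl
    | succ n hn ih => exact (hle n (hm.trans hn)).trans ih
  have key : ∀ x, Acc (Relation.TransGen Below) x → ∀ n, k ≤ n → f n ≠ x := by
    intro x hx
    induction hx with
    | intro x _ ih =>
      rintro n hn rfl
      obtain ⟨m, h1, h2, h3⟩ := hlt n
      exact ih _ (.trans_left h3 (hmono n m hn h1)) (m + 1) (by omega) rfl
  exact key _ hacc.transGen k le_rfl rfl

/-- A failure at the root propagates to an infinite branch. The values along its progressing thread
would descend forever in `Below`, although the first of them is computable at type `N`. -/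
theorem IsCoderivation.comp_of_sn {d : RuleTree} {S : Sequent} (hd : IsCoderivation d S)
    (hprog : d.Progressing) (hsn : ∀ v, d v ≠ none → SN (d.sub v).toTree) :
    Comp S.ty d.toTree := by
  obtain ⟨r, hr, rfl⟩ := Option.map_eq_some_iff.1 hd.1
  refine comp_of_apps fun xs hxs hc => ?_
  by_contra hn
  choose next G hpos hdesc using Failure.exists_next hd hsn
  let F : ℕ → Failure d := fun n => Nat.rec ⟨[], r, xs, hr, hxs, hc, hn⟩ (fun _ => G) n
  let b : ℕ → ℕ := fun n => next (F n)
  have halong : ∀ n, RuleTree.along b n = (F n).pos := by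
    intro n
    induction n with
    | zero => rfl
    | succ n ih => rw [RuleTree.along_succ, ih]; exact (hpos (F n)).symm
  obtain ⟨k, p, h1, h2⟩ := hprog b fun n => by rw [halong, (F n).rule_eq]; simp
  have hrule : ∀ n r, d (RuleTree.along b n) = some r → r = (F n).rule := fun n r h => by
    rw [halong, (F n).rule_eq] at h
    exact (Option.some.inj h).symm
  -- Since the arguments match the antecedent, each thread occurrence selects an actual argument of
  -- type `N`.
  have hval : ∀ n, k ≤ n → ∃ x, (F n).args[p n]? = some (Ty.N, x) := fun n hn => by
    obtain ⟨r, h3, h4, -⟩ := h1 n hn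
    rw [hrule n r h3, ← (F n).tys_eq, tys, List.getElem?_map, Option.map_eq_some_iff] at h4
    obtain ⟨⟨α, x⟩, h4, rfl⟩ := h4
    exact ⟨x, h4⟩
  choose! f hf using hval
  have hstep : ∀ n, k ≤ n → Relation.ReflTransGen Below (f (n + 1)) (f n) ∧
      ((F n).rule.CondPrincipal (p n) → Relation.TransGen Below (f (n + 1)) (f n)) := by
    intro n hn
    obtain ⟨r, h3, -, h4⟩ := h1 n hn
    rw [hrule n r h3] at h4
    obtain ⟨x, h5, h6⟩ := hdesc (F n) _ _ h4 _ (hf (n + 1) (by omega))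
    rw [hf n hn] at h5
    cases h5
    exact h6
  refine not_descending_of_acc (f := f) (k := k) ?_ (fun n hn => (hstep n hn).1) fun m => ?_
  · exact (F k).comp _ (List.mem_of_getElem? (hf k le_rfl))
  · obtain ⟨n, h3, h4, r, h5, h6⟩ := h2 m
    rw [hrule n r h5] at h6
    exact ⟨n, h3, h4, (hstep n h4).2 h6⟩

/-! ### Redexes and subtrees -/

theorem redexes_app_false {σ τ : Ty} {f x : CTree} {v : List Bool} (h : v ∈ f.redexes) :
    false :: v ∈ (CTree.app σ τ f x).redexes := h

theorem redexes_app_true {σ τ : Ty} {f x : CTree} {v : List Bool} (h : v ∈ x.redexes) :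
    true :: v ∈ (CTree.app σ τ f x).redexes := h

theorem Red.exists_redex {t u : CTree} (h : Red t u) : ∃ v, v ∈ t.redexes := by
  induction h with
  | contract h => exact ⟨[], _, h⟩
  | app_left _ _ _ _ ih => exact ⟨_, redexes_app_false ih.choose_spec⟩
  | app_right _ _ _ _ ih => exact ⟨_, redexes_app_true ih.choose_spec⟩

/-- The premisses of a coderivation occur in its coterm. -/
theorem exists_toTree_sub {d : RuleTree} {r : Rule} {i : ℕ} {S : Sequent} (h : d [] = some r)
    (hi : r.premises[i]? = some S) :
    ∃ w : List Bool, w ≠ [] ∧ ∀ v ∈ (d.sub [i]).toTree.redexes, w ++ v ∈ d.toTree.redexes := by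
  have : r.premises = [] ∨ (∃ S, r.premises = [S]) ∨ ∃ S S', r.premises = [S, S'] := by
    cases r <;> simp [Rule.premises]
  rcases this with h' | ⟨S, h'⟩ | ⟨S, S', h'⟩
  · simp [h'] at hi
  · obtain rfl : i = 0 := by
      have := (List.getElem?_eq_some_iff.1 hi).1
      simp [h'] at this
      omega
    rw [RuleTree.toTree_unary h h']
    exact ⟨[true], by simp, fun v hv => redexes_app_true hv⟩
  · have : i < 2 := by
      have := (List.getElem?_eq_some_iff.1 hi).1
      simpa [h'] using this
    rw [RuleTree.toTree_binary h h']
    interval_cases i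
    · exact ⟨[false, true], by simp, fun v hv => redexes_app_false (redexes_app_true hv)⟩
    · exact ⟨[true], by simp, fun v hv => redexes_app_true hv⟩

theorem IsCoderivation.redexes_sub_eq_empty {d : RuleTree} {S : Sequent}
    (hd : IsCoderivation d S) (h : d.toTree.redexes = ∅) (v : List ℕ) (hv : d v ≠ none) :
    (d.sub v).toTree.redexes = ∅ := by
  induction v using List.reverseRecOn with
  | nil => exact h
  | append_singleton v i ih =>
    obtain ⟨r', hr'⟩ := Option.ne_none_iff_exists'.1 hv
    have h1 := hd.2 v i
    rw [hr', Option.map_some, eq_comm, Option.bind_eq_some_iff] at h1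
    obtain ⟨r, hr, hi⟩ := h1
    obtain ⟨w, -, hw⟩ := exists_toTree_sub (d := d.sub v) (by simp [RuleTree.sub, hr]) hi
    rw [ih (by simp [hr]), RuleTree.sub_sub] at hw
    exact Set.eq_empty_of_forall_notMem fun u hu => hw u hu

theorem RuleTree.along_cons (i : ℕ) (b : ℕ → ℕ) (n : ℕ) :
    along (fun m => Nat.casesOn m i b) (n + 1) = i :: along b n := by
  simp [along, List.range_succ_eq_map, Function.comp_def]

theorem RuleTree.Progressing.sub {d : RuleTree} {r : Rule} (h : d.Progressing) (hr : d [] = some r)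
    (i : ℕ) : (d.sub [i]).Progressing := by
  intro b hb
  have hd : ∀ n, d (along (fun m => Nat.casesOn m i b) (n + 1)) = (d.sub [i]) (along b n) :=
    fun n => by rw [along_cons]; rfl
  obtain ⟨k, p, h1, h2⟩ := h (fun m => Nat.casesOn m i b) fun n => by
    cases n with
    | zero => change d [] ≠ none; simp [hr]
    | succ n => rw [hd]; exact hb n
  refine ⟨k, fun n => p (n + 1), fun n hn => ?_, fun m => ?_⟩
  · obtain ⟨r, h3, h4⟩ := h1 (n + 1) (by omega)
    rw [hd] at h3
    exact ⟨r, h3, h4⟩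
  -- The bound keeps the index positive and its predecessor at least `m` and `k` after the first
  -- node is dropped.
  · obtain ⟨n, h3, h4, r, h5, h6⟩ := h2 (m + k + 1)
    obtain ⟨n, rfl⟩ : ∃ l, n = l + 1 := ⟨n - 1, by omega⟩
    rw [hd] at h5
    exact ⟨n, by omega, by omega, r, h5, h6⟩

/-- Unfolding the root gives a computable constant applied to premisses whose redexes are strictly
less deep. When none remain, every sub-coderivation has a normal coterm and the descent argument
applies. -/
theorem comp_of_redexes_length_lt (D : ℕ) {d : RuleTree} {S : Sequent} (hd : IsCoderivation d S)
    (hprog : d.Progressing) (hD : ∀ v ∈ d.toTree.redexes, v.length < D) : Comp S.ty d.toTree := by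
  induction D generalizing d S with
  | zero =>
    have h : d.toTree.redexes = ∅ :=
      Set.eq_empty_of_forall_notMem fun v hv => Nat.not_lt_zero _ (hD v hv)
    refine hd.comp_of_sn hprog fun v hv => ⟨_, fun u hu => ?_⟩
    obtain ⟨w, hw⟩ := Red.exists_redex hu
    rw [hd.redexes_sub_eq_empty h v hv] at hw
    exact hw.elim
  | succ D ih =>
    obtain ⟨r, hr, rfl⟩ := Option.map_eq_some_iff.1 hd.1
    rw [toTree_eq_apps hr]
    refine comp_apps ?_ ?_
    · rw [tys, List.map_fst_zip (by simp)]
      exact comp_const r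
    · intro x hx
      obtain ⟨i, hi⟩ := List.mem_iff_getElem?.1 hx
      obtain ⟨h1, h2⟩ := List.getElem?_zip_eq_some.1 hi
      rw [List.getElem?_map, Option.map_eq_some_iff] at h1 h2
      obtain ⟨S, h1, h3⟩ := h1
      obtain ⟨j, h2, h4⟩ := h2
      obtain ⟨_, rfl⟩ := List.getElem?_eq_some_iff.1 h2
      rw [List.getElem_range] at h4
      obtain ⟨w, hw, h5⟩ := exists_toTree_sub hr h1
      rw [← h3, ← h4]
      refine ih (hd.sub hr h1) (hprog.sub hr i) fun v hv => ?_
      have h6 := hD _ (h5 v hv)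
      have h7 := List.length_pos_iff.2 hw
      rw [List.length_append] at h6
      omega

/-- Finiteness passes to both sides of an application, as their redex positions embed injectively;
at a coderivation it bounds the depth of redexes. -/
theorem IsCT.comp {t : CTree} {σ : Ty} (h : IsCT t σ) (hfin : t.redexes.Finite) : Comp σ t := by
  induction h with
  | var x σ => exact comp_var x σ
  | const r => exact comp_const r
  | coderivation hd _ hprog =>
    obtain ⟨D, hD⟩ := (hfin.image List.length).bddAbove
    exact comp_of_redexes_length_lt (D + 1) hd hprog fun v hv =>
      Nat.lt_succ_of_le (hD (Set.mem_image_of_mem _ hv))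
  | app _ _ ihs iht =>
    refine ihs ?_ _ (iht ?_)
    · exact Set.Finite.of_finite_image (f := List.cons false)
        (hfin.subset (by rintro _ ⟨v, hv, rfl⟩; exact redexes_app_false hv))
        (List.cons_injective.injOn)
    · exact Set.Finite.of_finite_image (f := List.cons true)
        (hfin.subset (by rintro _ ⟨v, hv, rfl⟩; exact redexes_app_true hv))
        (List.cons_injective.injOn)

end CircularT

theorem mainTheorem10 (σ : CircularT.Ty) (t : CircularT.CTree) (ht : CircularT.IsCT t σ)
    (hclosed : t.Closed) (hfin : t.redexes.Finite) :
    t.StronglyNormalising ∧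
      ∃! u : CircularT.CTree, t.Reds u ∧ u.Normal := by
  have hsn : CircularT.SN t := (ht.comp hfin).sn
  obtain ⟨u, h1, h2⟩ := hsn.exists_normal
  exact ⟨hsn.stronglyNormalising, u, ⟨h1, h2⟩, fun v hv => hsn.normal_unique hv.1 hv.2 h1 h2⟩
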